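/- Let $I=(a,b)$ be a bounded interval, let $k\ge 0$ be an integer and let $0\le s\le k$ be real. For real $t\ge 0$ let $H^t(I)$ be the usual ($L_2$-based) Sobolev space with norm $\|\cdot\|_t$ (for non-integer $t$, the Sobolev–Slobodeckij space). Let $a_2\in H^{s+1}(I)$ with $a_2\ge a_{\min}$ for a constant $a_{\min}>0$, and let $a_0\in H^1(I)$ with $a_0\ge 0$. For $f\in L_2(I)$ consider the problem $$-(a_2u')'+a_0u=f \ \text{ in } I,\qquad u(a)=0,\quad u'(b)=0. \tag{1}$$ Let $I_h: a=x_1<x_2<\dots<x_N=b$ be a partition with elements $I_i=(x_i,x_{i+1})$, lengths $h_i=x_{i+1}-x_i$ $(1\le i\le N-1)$ and mesh size $h=\max_i h_i$. Let $P_m(I_i)$ denote the polynomials of degree at most $m$ on $I_i$. Let $S_h$ be the space of weak functions $v$ that consist of an interior component $v^0$ with $v^0|_{I_i}\in P_k(I_i)$ for every $i$ and of nodal values $v^1=0,v^2,\dots,v^N\in\mathbb R$ (one for each mesh point, not necessarily traces of $v^0$). For $v\in S_h$, the discrete weak derivative $d_{w,r}v$, with $r=k+1$, is on each $I_i$ the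 unique element of $P_r(I_i)$ with $$\int_{I_i} d_{w,r}v\,q\,dx=-\int_{I_i}v^0q'\,dx+v^{i+1}q(x_{i+1})-v^iq(x_i)\qquad\text{for all } q\in P_r(I_i).$$ The weak finite element solution $u_h\in S_h$ is defined by $$\sum_{i=1}^{N-1}\int_{I_i}a_2\,d_{w,r}u_h\,d_{w,r}v\,dx+\int_I a_0u_h^0v^0\,dx=\int_I f v^0\,dx\qquad\text{for all } v\in S_h. \tag{2}$$ **Theorem 4.6.** Let $\sigma>0$. There is a constant $C>0$, depending only on $a,b,k,s,a_2,a_0,a_{\min},\sigma$ (in particular independent of the partition, of $f$ and of $u$), such that for every partition $I_h$ that is quasi-uniform with constant $\sigma$, that is, $h/h_i\le\sigma$ for $i=1,\dots,N-1$, and for all solutions $u$ of (1) and $u_h$ of (2) with $u\in H^{s+2}(I)$, $$\|u-u_h^0\|_{L_\infty(I)}\le C\,h^{s+1}\,\|u\|_{s+2}.$$ -/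

import Mathlib

open MeasureTheory Set Polynomial
open scoped ENNReal

noncomputable section

namespace WeakFE

/-! ### Sobolev spaces on a bounded interval -/

/-- `g` is the weak (distributional) derivative of order `m` of `u` on the open interval `(a, b)`. -/
def IsWeakDeriv (a b : ℝ) (m : ℕ) (u g : ℝ → ℝ) : Prop :=
  LocallyIntegrableOn u (Ioo a b) ∧ LocallyIntegrableOn g (Ioo a b) ∧
    ∀ φ : ℝ → ℝ, ContDiff ℝ (⊤ : ℕ∞) φ → HasCompactSupport φ → tsupport φ ⊆ Ioo a b →
      ∫ x in Ioo a b, u x * iteratedDeriv m φ x = (-1) ^ m * ∫ x in Ioo a b, g x * φ x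

open Classical in
/-- The weak derivative of order `m` of `u` on `(a, b)`. It is unique up to a null set
when it exists, and it is `0` by convention when it does not. -/
def weakDeriv (a b : ℝ) (m : ℕ) (u : ℝ → ℝ) : ℝ → ℝ :=
  if h : ∃ g, IsWeakDeriv a b m u g then h.choose else 0

/-- The square of the Gagliardo (Slobodeckij) seminorm of order `θ` on `(a, b)`. -/
def gagliardoSq (a b θ : ℝ) (g : ℝ → ℝ) : ℝ≥0∞ :=
  ∫⁻ x in Ioo a b, ∫⁻ y in Ioo a b, ENNReal.ofReal (|g x - g y| ^ 2 / |x - y| ^ (1 + 2 * θ))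

/-- The fractional part of the square of the norm of `H^t(a, b)`; it is absent when `t` is a
natural number. -/
def fracPartSq (a b t : ℝ) (u : ℝ → ℝ) : ℝ≥0∞ :=
  if Int.fract t = 0 then 0 else gagliardoSq a b (Int.fract t) (weakDeriv a b ⌊t⌋₊ u)

/-- The Sobolev space `H^t(a, b) = W^{t,2}(a, b)` for real `t ≥ 0`: the weak derivatives up to
order `⌊t⌋` are in `L²(a, b)`, and, when `t` is not an integer, the one of order `⌊t⌋` has a finite
Gagliardo seminorm of order `t - ⌊t⌋`. -/
def MemSobolev (a b t : ℝ) (u : ℝ → ℝ) : Prop :=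
  (∀ m : ℕ, m ≤ ⌊t⌋₊ → ∃ g, IsWeakDeriv a b m u g ∧ MemLp g 2 (volume.restrict (Ioo a b))) ∧
    fracPartSq a b t u < ∞

/-- The norm of `H^t(a, b)`. It is finite on the functions that satisfy `MemSobolev a b t`. -/
def sobolevNorm (a b t : ℝ) (u : ℝ → ℝ) : ℝ≥0∞ :=
  (∑ m ∈ Finset.range (⌊t⌋₊ + 1),
      eLpNorm (weakDeriv a b m u) 2 (volume.restrict (Ioo a b)) ^ 2
    + fracPartSq a b t u) ^ (1 / 2 : ℝ)

/-- The continuous representative of `u` on `[a, b]` takes the value `c` at the point `x`. -/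
def HasTrace (a b : ℝ) (u : ℝ → ℝ) (x c : ℝ) : Prop :=
  ∃ w : ℝ → ℝ, ContinuousOn w (Icc a b) ∧ w =ᵐ[volume.restrict (Ioo a b)] u ∧ w x = c

/-! ### The boundary value problem -/

/-- `u ∈ H²(a, b)` is the solution of `-(a₂ u')' + a₀ u = f` in `(a, b)`, `u(a) = 0`, `u'(b) = 0`.
The equation is written as `(a₂ u')' = a₀ u - f`. -/
structure IsSolution (a b : ℝ) (a₂ a₀ f u : ℝ → ℝ) : Prop where
  memSobolev : MemSobolev a b 2 u
  eqn : IsWeakDeriv a b 1 (fun x => a₂ x * weakDeriv a b 1 u x) (fun x => a₀ x * u x - f x)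
  left_bc : HasTrace a b u a 0
  right_bc : HasTrace a b (weakDeriv a b 1 u) b 0

/-! ### Partitions -/

/-- A partition `a = x₀ < x₁ < ⋯ < xₙ = b` of the interval `(a, b)`. -/
structure Mesh (a b : ℝ) where
  /-- the number `n` of elements -/
  n : ℕ
  /-- the mesh points -/
  pt : Fin (n + 1) → ℝ
  strictMono : StrictMono pt
  pt_zero : pt 0 = a
  pt_last : pt (Fin.last n) = b

namespace Mesh

variable {a b : ℝ} (M : Mesh a b)

/-- The left endpoint of an element. -/
def left (i : Fin M.n) : ℝ := M.pt i.castSucc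

/-- The right endpoint of an element. -/
def right (i : Fin M.n) : ℝ := M.pt i.succ

/-- The length `hᵢ` of an element. -/
def len (i : Fin M.n) : ℝ := M.right i - M.left i

/-- The mesh size `h = max hᵢ`. -/
def size : ℝ := ⨆ i, M.len i

/-- Quasi-uniformity with constant `σ`. -/
def QuasiUniform (σ : ℝ) : Prop := ∀ i, M.size / M.len i ≤ σ

end Mesh

/-! ### The discrete weak derivative -/

/-- `d` is a polynomial of degree at most `r` with
`∫ d q = -∫ v⁰ q' + vᵇ q(xb) - vᵃ q(xa)` over `(xa, xb)` for all polynomials `q` of degree at most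
`r`, that is, `d` is the discrete weak derivative of the weak function `{v⁰, vᵃ, vᵇ}`. -/
def IsDiscreteWeakDeriv (xa xb : ℝ) (r : ℕ) (v0 : ℝ → ℝ) (va vb : ℝ) (d : ℝ[X]) : Prop :=
  d.natDegree ≤ r ∧ ∀ q : ℝ[X], q.natDegree ≤ r →
    ∫ x in xa..xb, d.eval x * q.eval x =
      -(∫ x in xa..xb, v0 x * q.derivative.eval x) + vb * q.eval xb - va * q.eval xa

/-- The discrete weak derivative exists and is unique on every nondegenerate interval. -/
theorem existsUnique_isDiscreteWeakDeriv {xa xb : ℝ} (hab : xa < xb) (r : ℕ) {v0 : ℝ → ℝ}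
    (hv : IntervalIntegrable v0 volume xa xb) (va vb : ℝ) :
    ∃! d : ℝ[X], IsDiscreteWeakDeriv xa xb r v0 va vb d := by
  have hint : ∀ p q : ℝ[X], IntervalIntegrable (fun x => p.eval x * q.eval x) volume xa xb :=
    fun p q => (p.continuous.mul q.continuous).intervalIntegrable _ _
  have hint' : ∀ q : ℝ[X], IntervalIntegrable (fun x => v0 x * q.eval x) volume xa xb :=
    fun q => hv.mul_continuousOn q.continuous.continuousOn
  have key : ∀ p : ℝ[X], ∫ x in xa..xb, p.eval x * p.eval x = 0 → p = 0 := by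
    intro p hp
    by_contra hne
    have hfin : (p.roots.toFinset : Set ℝ).Finite := Finset.finite_toSet _
    obtain ⟨c, hc, hcr⟩ := ((Ioo_infinite hab).sdiff hfin).nonempty
    have hc0 : p.eval c ≠ 0 := by
      intro h0
      exact hcr (by simp [hne, h0])
    have : 0 < ∫ x in xa..xb, p.eval x * p.eval x :=
      intervalIntegral.integral_pos hab (p.continuous.mul p.continuous).continuousOn
        (fun x _ => mul_self_nonneg _) ⟨c, Ioo_subset_Icc_self hc, mul_self_pos.2 hc0⟩
    exact this.ne' hp
  let V := degreeLT ℝ (r + 1)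
  have hV : ∀ p : ℝ[X], p ∈ V ↔ p.natDegree ≤ r := by
    intro p
    rw [mem_degreeLT]
    by_cases hp : p = 0
    · simp [hp]
    · rw [degree_eq_natDegree hp, Nat.cast_lt, Nat.lt_succ_iff]
  have : FiniteDimensional ℝ V := LinearEquiv.finiteDimensional (degreeLTEquiv ℝ (r + 1)).symm
  let B : V →ₗ[ℝ] Module.Dual ℝ V := LinearMap.mk₂ ℝ
    (fun p q => ∫ x in xa..xb, (p : ℝ[X]).eval x * (q : ℝ[X]).eval x)
    (by intro p p' q
        simp only [Submodule.coe_add, eval_add, add_mul]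
        exact intervalIntegral.integral_add (hint _ _) (hint _ _))
    (by intro c p q
        simp only [Submodule.coe_smul, eval_smul, smul_eq_mul, mul_assoc]
        exact intervalIntegral.integral_const_mul _ _)
    (by intro p q q'
        simp only [Submodule.coe_add, eval_add, mul_add]
        exact intervalIntegral.integral_add (hint _ _) (hint _ _))
    (by intro c p q
        simp only [Submodule.coe_smul, eval_smul, smul_eq_mul, mul_left_comm _ c]
        exact intervalIntegral.integral_const_mul _ _)
  have hBinj : Function.Injective B := by
    rw [injective_iff_map_eq_zero]
    intro p hp
    have h0 : B p p = 0 := by rw [hp]; rfl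
    exact Subtype.ext (key p h0)
  have hBsurj : Function.Surjective B :=
    (LinearMap.injective_iff_surjective_of_finrank_eq_finrank
      (Subspace.dual_finrank_eq).symm).1 hBinj
  let F : Module.Dual ℝ V :=
    { toFun := fun q => -(∫ x in xa..xb, v0 x * (q : ℝ[X]).derivative.eval x)
        + vb * (q : ℝ[X]).eval xb - va * (q : ℝ[X]).eval xa
      map_add' := by
        intro p q
        simp only [Submodule.coe_add, derivative_add, eval_add, mul_add]
        rw [intervalIntegral.integral_add (hint' _) (hint' _)]
        ring
      map_smul' := by
        intro c q
        simp only [Submodule.coe_smul, derivative_smul, eval_smul, smul_eq_mul,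
          mul_left_comm _ c, RingHom.id_apply]
        rw [intervalIntegral.integral_const_mul]
        ring }
  obtain ⟨d, hd⟩ := hBsurj F
  refine ⟨d, ⟨(hV _).1 d.2, fun q hq => ?_⟩, ?_⟩
  · exact LinearMap.congr_fun hd ⟨q, (hV q).2 hq⟩
  · rintro d' ⟨hd', hd'q⟩
    have : B ⟨d', (hV _).2 hd'⟩ = F := by
      ext q
      exact hd'q q ((hV _).1 q.2)
    exact congrArg Subtype.val (hBinj (this.trans hd.symm))

open Classical in
/-- The discrete weak derivative `d_{w,r} v` of the weak function `v = {v⁰, vᵃ, vᵇ}` on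
`[xa, xb]`. -/
def discreteWeakDeriv (xa xb : ℝ) (r : ℕ) (v0 : ℝ → ℝ) (va vb : ℝ) : ℝ[X] :=
  if h : ∃ d, IsDiscreteWeakDeriv xa xb r v0 va vb d then h.choose else 0

/-! ### The weak finite element method -/

/-- The weak finite element space `S_h`: polynomials `v⁰` of degree at most `k` in the elements, and
values at the mesh points, which need not be the traces of `v⁰`. The jumps at the interior mesh
points vanish, so that there is one value for each mesh point; the value at the point `a` is `0`. -/
structure FESpace {a b : ℝ} (M : Mesh a b) (k : ℕ) where
  /-- the component `v⁰` in each element -/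
  interior : Fin M.n → ℝ[X]
  /-- the values at the mesh points -/
  val : Fin (M.n + 1) → ℝ
  natDegree_le : ∀ i, (interior i).natDegree ≤ k
  val_zero : val 0 = 0

namespace FESpace

variable {a b : ℝ} {M : Mesh a b} {k : ℕ} (v : FESpace M k)

/-- The interior component `v⁰` as a function on `(a, b)` (set to `0` on the null set of mesh
points). -/
def fn (x : ℝ) : ℝ :=
  ∑ i, (Ioo (M.left i) (M.right i)).indicator (fun y => (v.interior i).eval y) x

/-- The discrete weak derivative `d_{w,r} v` on the element `i`. -/
def dw (r : ℕ) (i : Fin M.n) : ℝ[X] :=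
  discreteWeakDeriv (M.left i) (M.right i) r (fun x => (v.interior i).eval x)
    (v.val i.castSucc) (v.val i.succ)

end FESpace

/-- `uh ∈ S_h` solves
`(a₂ d_{w,r} uh, d_{w,r} v)_h + (a₀ uh⁰, v⁰) = (f, v⁰)` for all `v ∈ S_h`. -/
def IsWeakFESolution {a b : ℝ} {M : Mesh a b} {k : ℕ} (r : ℕ) (a₂ a₀ f : ℝ → ℝ)
    (uh : FESpace M k) : Prop :=
  ∀ v : FESpace M k,
    (∑ i, ∫ x in (M.left i)..(M.right i), a₂ x * (uh.dw r i).eval x * (v.dw r i).eval x)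
      + ∫ x in a..b, a₀ x * uh.fn x * v.fn x = ∫ x in a..b, f x * v.fn x

end WeakFE

end

noncomputable section

namespace WeakFE

/-! ### Primitives of integrable functions -/

/-- On `[a, b]` the function `w` is a primitive of the integrable function `g`. -/
def IsPrim (a b : ℝ) (w g : ℝ → ℝ) : Prop :=
  IntervalIntegrable g volume a b ∧ ∀ x ∈ Icc a b, w x = w a + ∫ t in a..x, g t

namespace IsPrim

variable {a b c d : ℝ} {w v g g' : ℝ → ℝ}

theorem integrable_sub (h : IsPrim a b w g) {x y : ℝ} (hx : x ∈ Icc a b) (hy : y ∈ Icc a b) :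
    IntervalIntegrable g volume x y := by
  have hab : a ≤ b := hx.1.trans hx.2
  refine h.1.mono_set ?_
  rw [uIcc_of_le hab]
  exact (convex_Icc a b).ordConnected.uIcc_subset hx hy

theorem sub_eq (h : IsPrim a b w g) {x y : ℝ} (hx : x ∈ Icc a b) (hy : y ∈ Icc a b) :
    w y - w x = ∫ t in x..y, g t := by
  have hab : a ≤ b := hx.1.trans hx.2
  have ha : a ∈ Icc a b := left_mem_Icc.2 hab
  rw [h.2 x hx, h.2 y hy,
    ← intervalIntegral.integral_interval_sub_left (h.integrable_sub ha hy) (h.integrable_sub ha hx)]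
  ring

theorem mono (h : IsPrim a b w g) (hc : c ∈ Icc a b) (hd : d ∈ Icc a b) : IsPrim c d w g := by
  refine ⟨h.integrable_sub hc hd, fun x hx => ?_⟩
  have := h.sub_eq hc (y := x) ⟨hc.1.trans hx.1, hx.2.trans hd.2⟩
  linarith

theorem ac (h : IsPrim a b w g) (hab : a ≤ b) : AbsolutelyContinuousOnInterval w a b := by
  have h1 := h.1.absolutelyContinuousOnInterval_intervalIntegral (c := a) (by simp)
  rw [absolutelyContinuousOnInterval_iff] at h1 ⊢
  intro ε hε
  obtain ⟨δ, hδ, H⟩ := h1 ε hε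
  refine ⟨δ, hδ, fun E hE hs => ?_⟩
  refine lt_of_eq_of_lt (Finset.sum_congr rfl fun i hi => ?_) (H E hE hs)
  have hm := hE.1 i hi
  rw [uIcc_of_le hab] at hm
  rw [h.2 _ hm.1, h.2 _ hm.2]
  simp

theorem continuousOn (h : IsPrim a b w g) : ContinuousOn w (Icc a b) := by
  rcases le_or_gt a b with hab | hab
  · simpa [uIcc_of_le hab] using (h.ac hab).continuousOn
  · simp [Icc_eq_empty_of_lt hab]

theorem ae_deriv (h : IsPrim a b w g) : ∀ᵐ x, x ∈ Ioo a b → deriv w x = g x := by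
  filter_upwards [h.1.ae_hasDerivAt_integral] with x hx hxI
  have hab : a ≤ b := (hxI.1.trans hxI.2).le
  have h1 := hx (by rw [uIcc_of_le hab]; exact Ioo_subset_Icc_self hxI) a (by simp)
  have h2 : HasDerivAt (fun y => w a + ∫ t in a..y, g t) (g x) x := h1.const_add (w a)
  refine (h2.congr_of_eventuallyEq ?_).deriv
  filter_upwards [isOpen_Ioo.mem_nhds hxI] with y hy
  exact h.2 y (Ioo_subset_Icc_self hy)

theorem congr_deriv (hab : a ≤ b) (h : IsPrim a b w g) (hgg : g =ᵐ[volume.restrict (Ioo a b)] g') :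
    IsPrim a b w g' := by
  have hI : IntervalIntegrable g' volume a b := by
    have := h.1
    rw [intervalIntegrable_iff_integrableOn_Ioo_of_le hab] at this ⊢
    exact this.congr hgg
  refine ⟨hI, fun x hx => ?_⟩
  rw [h.2 x hx, intervalIntegral.integral_of_le hx.1, intervalIntegral.integral_of_le hx.1,
    integral_Ioc_eq_integral_Ioo, integral_Ioc_eq_integral_Ioo]
  congr 1
  refine integral_congr_ae (ae_restrict_of_ae_restrict_of_subset ?_ hgg)
  exact Ioo_subset_Ioo_right hx.2

theorem of_ac (hab : a ≤ b) (h : AbsolutelyContinuousOnInterval w a b) :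
    IsPrim a b w (deriv w) := by
  refine ⟨h.intervalIntegrable_deriv, fun x hx => ?_⟩
  have h1 : AbsolutelyContinuousOnInterval w a x := h.mono (by
    rw [uIcc_of_le hab, uIcc_of_le hx.1]; exact Icc_subset_Icc_right hx.2)
  rw [h1.integral_deriv_eq_sub]
  ring

theorem mul (hab : a ≤ b) (hw : IsPrim a b w g) (hv : IsPrim a b v g') :
    IsPrim a b (fun x => w x * v x) (fun x => g x * v x + w x * g' x) := by
  have h := of_ac hab ((hw.ac hab).fun_mul (hv.ac hab))
  refine h.congr_deriv hab ?_
  rw [Filter.EventuallyEq, ae_restrict_iff' measurableSet_Ioo]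
  filter_upwards [hw.ae_deriv, hv.ae_deriv, (hw.ac hab).ae_differentiableAt,
    (hv.ac hab).ae_differentiableAt] with x h1 h2 h3 h4 hx
  have hx' : x ∈ uIcc a b := by rw [uIcc_of_le hab]; exact Ioo_subset_Icc_self hx
  rw [← h1 hx, ← h2 hx]
  exact ((h3 hx').hasDerivAt.mul (h4 hx').hasDerivAt).deriv

theorem add (hw : IsPrim a b w g) (hv : IsPrim a b v g') :
    IsPrim a b (fun x => w x + v x) (fun x => g x + g' x) := by
  refine ⟨hw.1.add hv.1, fun x hx => ?_⟩
  have ha : a ∈ Icc a b := left_mem_Icc.2 (hx.1.trans hx.2)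
  beta_reduce
  rw [hw.2 x hx, hv.2 x hx, intervalIntegral.integral_add (hw.integrable_sub ha hx)
    (hv.integrable_sub ha hx)]
  ring

theorem of_deriv (h : ∀ x, HasDerivAt w (g x) x) (hg : Continuous g) (a b : ℝ) :
    IsPrim a b w g := by
  refine ⟨hg.intervalIntegrable _ _, fun x _ => ?_⟩
  rw [intervalIntegral.integral_eq_sub_of_hasDerivAt (fun y _ => h y) (hg.intervalIntegrable _ _)]
  ring

theorem polynomial (p : ℝ[X]) (a b : ℝ) :
    IsPrim a b (fun x => p.eval x) (fun x => p.derivative.eval x) :=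
  of_deriv (fun x => p.hasDerivAt x) p.derivative.continuous a b

/-- Integration by parts. -/
theorem parts (hab : a ≤ b) (hw : IsPrim a b w g) (hv : IsPrim a b v g') :
    ∫ x in a..b, g x * v x = w b * v b - w a * v a - ∫ x in a..b, w x * g' x := by
  have h := (hw.mul hab hv).sub_eq (left_mem_Icc.2 hab) (right_mem_Icc.2 hab)
  rw [intervalIntegral.integral_add] at h
  · linarith
  · exact hw.1.mul_continuousOn (by rw [uIcc_of_le hab]; exact hv.continuousOn)
  · exact hv.1.continuousOn_mul (by rw [uIcc_of_le hab]; exact hw.continuousOn)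

end IsPrim

/-! ### Square integrable functions -/

theorem sq_integral_mul_le {α : Type*} [MeasurableSpace α] {μ : Measure α} {f g : α → ℝ}
    (hf : MemLp f 2 μ) (hg : MemLp g 2 μ) :
    (∫ x, f x * g x ∂μ) ^ 2 ≤ (∫ x, f x ^ 2 ∂μ) * ∫ x, g x ^ 2 ∂μ := by
  have hfg : Integrable (fun x => f x * g x) μ := hf.integrable_mul hg
  have key : ∀ t : ℝ, 0 ≤ (∫ x, g x ^ 2 ∂μ) * (t * t) + (2 * ∫ x, f x * g x ∂μ) * t
      + ∫ x, f x ^ 2 ∂μ := by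
    intro t
    have h0 : 0 ≤ ∫ x, (t ^ 2 * g x ^ 2 + (2 * t) * (f x * g x) + f x ^ 2) ∂μ :=
      integral_nonneg fun x => by
        show 0 ≤ t ^ 2 * g x ^ 2 + (2 * t) * (f x * g x) + f x ^ 2
        nlinarith [sq_nonneg (t * g x + f x)]
    have hA : Integrable (fun x => t ^ 2 * g x ^ 2 + (2 * t) * (f x * g x)) μ :=
      (hg.integrable_sq.const_mul _).add (hfg.const_mul _)
    rw [integral_add hA hf.integrable_sq,
      integral_add (hg.integrable_sq.const_mul _) (hfg.const_mul _), integral_const_mul,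
      integral_const_mul] at h0
    nlinarith
  have := discrim_le_zero key
  rw [discrim] at this
  nlinarith

/-- Square integrability on `(c, d)`. -/
abbrev L2 (c d : ℝ) (f : ℝ → ℝ) : Prop := MemLp f 2 (volume.restrict (Ioo c d))

namespace L2

variable {a b c d : ℝ} {f g : ℝ → ℝ}

theorem mono (h : L2 a b f) (hac : a ≤ c) (hdb : d ≤ b) : L2 c d f :=
  h.mono_measure (Measure.restrict_mono (Ioo_subset_Ioo hac hdb) le_rfl)

theorem of_continuousOn (h : ContinuousOn f (Icc c d)) : L2 c d f := by
  obtain ⟨K, hK⟩ := isCompact_Icc.exists_bound_of_continuousOn h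
  refine MemLp.of_bound ((h.mono Ioo_subset_Icc_self).aestronglyMeasurable measurableSet_Ioo) K ?_
  filter_upwards [ae_restrict_mem measurableSet_Ioo] with x hx
  exact hK x (Ioo_subset_Icc_self hx)

theorem intervalIntegrable (h : L2 c d f) (hcd : c ≤ d) : IntervalIntegrable f volume c d := by
  rw [intervalIntegrable_iff_integrableOn_Ioo_of_le hcd]
  exact h.integrable (by norm_num)

theorem intervalIntegrable_mul (hf : L2 c d f) (hg : L2 c d g) (hcd : c ≤ d) :
    IntervalIntegrable (fun x => f x * g x) volume c d := by
  rw [intervalIntegrable_iff_integrableOn_Ioo_of_le hcd]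
  exact hf.integrable_mul hg

theorem intervalIntegrable_sq (hf : L2 c d f) (hcd : c ≤ d) :
    IntervalIntegrable (fun x => f x ^ 2) volume c d := by
  rw [intervalIntegrable_iff_integrableOn_Ioo_of_le hcd]
  exact hf.integrable_sq

theorem cauchySchwarz (hf : L2 c d f) (hg : L2 c d g) (hcd : c ≤ d) :
    (∫ x in c..d, f x * g x) ^ 2 ≤ (∫ x in c..d, f x ^ 2) * ∫ x in c..d, g x ^ 2 := by
  simp only [intervalIntegral.integral_of_le hcd, integral_Ioc_eq_integral_Ioo]
  exact sq_integral_mul_le hf hg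

theorem sq_integral_le (hf : L2 c d f) (hcd : c ≤ d) :
    (∫ x in c..d, f x) ^ 2 ≤ (d - c) * ∫ x in c..d, f x ^ 2 := by
  have h := hf.cauchySchwarz (of_continuousOn (f := fun _ => (1 : ℝ)) continuousOn_const) hcd
  simp only [mul_one, one_pow, intervalIntegral.integral_const, smul_eq_mul] at h
  linarith

theorem sq_integral_abs_le (hf : L2 c d f) (hcd : c ≤ d) :
    (∫ x in c..d, |f x|) ^ 2 ≤ (d - c) * ∫ x in c..d, f x ^ 2 := by
  have h := (show L2 c d (fun x => |f x|) from hf.abs).sq_integral_le hcd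
  simpa only [sq_abs] using h

end L2

theorem ae_eq_on_continuousOn {a b : ℝ} (hab : a < b) {f g : ℝ → ℝ} (hf : ContinuousOn f (Icc a b))
    (hg : ContinuousOn g (Icc a b)) (h : f =ᵐ[volume.restrict (Ioo a b)] g) :
    EqOn f g (Icc a b) := by
  have h1 : f =ᵐ[volume.restrict (Icc a b)] g := by
    rwa [Measure.restrict_congr_set Ioo_ae_eq_Icc.symm]
  exact Measure.eqOn_Icc_of_ae_eq volume hab.ne h1 hf hg

/-! ### The discrete weak derivative -/

theorem discreteWeakDeriv_spec {xa xb : ℝ} (hab : xa < xb) (r : ℕ) {v0 : ℝ → ℝ}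
    (hv : IntervalIntegrable v0 volume xa xb) (va vb : ℝ) :
    IsDiscreteWeakDeriv xa xb r v0 va vb (discreteWeakDeriv xa xb r v0 va vb) := by
  have h := (existsUnique_isDiscreteWeakDeriv hab r hv va vb).exists
  rw [discreteWeakDeriv, dif_pos h]
  exact h.choose_spec

theorem L2.polynomial (p : ℝ[X]) (c d : ℝ) : L2 c d (fun x => p.eval x) :=
  .of_continuousOn p.continuous.continuousOn

/-- The `L²` projection onto the polynomials of degree at most `r`. -/
theorem exists_projection {l r : ℝ} (hlr : l < r) (k : ℕ) {w : ℝ → ℝ}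
    (hw : IntervalIntegrable w volume l r) :
    ∃ p : ℝ[X], p.natDegree ≤ k ∧ ∀ q : ℝ[X], q.natDegree ≤ k →
      ∫ x in l..r, p.eval x * q.eval x = ∫ x in l..r, w x * q.eval x := by
  have hW : IsPrim l r (fun x => ∫ t in l..x, w t) w := ⟨hw, fun x _ => by simp⟩
  obtain ⟨d, hd, -⟩ := existsUnique_isDiscreteWeakDeriv hlr k
    (L2.intervalIntegrable (.of_continuousOn hW.continuousOn) hlr.le) 0 (∫ t in l..r, w t)
  refine ⟨d, hd.1, fun q hq => ?_⟩
  rw [hd.2 q hq, hW.parts hlr.le (.polynomial q l r)]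
  simp
  ring

/-- The `L²` projection is the best approximation in `L²`. -/
theorem projection_sq_le {l r : ℝ} (hlr : l < r) {k : ℕ} {w : ℝ → ℝ} (hw : L2 l r w) {p : ℝ[X]}
    (hp : p.natDegree ≤ k) (hproj : ∀ q : ℝ[X], q.natDegree ≤ k →
      ∫ x in l..r, p.eval x * q.eval x = ∫ x in l..r, w x * q.eval x)
    {q : ℝ[X]} (hq : q.natDegree ≤ k) :
    (∫ x in l..r, (w x - p.eval x) ^ 2) ≤ ∫ x in l..r, (w x - q.eval x) ^ 2 ∧
    (∫ x in l..r, (p - q).eval x ^ 2) ≤ ∫ x in l..r, (w x - q.eval x) ^ 2 := by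
  have hpL := L2.polynomial p l r
  have hpq := L2.polynomial (p - q) l r
  have hwp : L2 l r (fun x => w x - p.eval x) := hw.sub hpL
  have h0 : ∫ x in l..r, (w x - p.eval x) * (p - q).eval x = 0 := by
    have hd : (p - q).natDegree ≤ k := (natDegree_sub_le _ _).trans (max_le hp hq)
    have := hproj _ hd
    simp only [sub_mul]
    rw [intervalIntegral.integral_sub (hw.intervalIntegrable_mul hpq hlr.le)
      (hpL.intervalIntegrable_mul hpq hlr.le)]
    linarith
  have h1 : ∫ x in l..r, (w x - q.eval x) ^ 2 = (∫ x in l..r, (w x - p.eval x) ^ 2)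
      + 2 * (∫ x in l..r, (w x - p.eval x) * (p - q).eval x)
      + ∫ x in l..r, (p - q).eval x ^ 2 := by
    rw [← intervalIntegral.integral_const_mul, ← intervalIntegral.integral_add,
      ← intervalIntegral.integral_add]
    · refine intervalIntegral.integral_congr fun x _ => ?_
      simp only [eval_sub]
      ring
    · exact (hwp.intervalIntegrable_sq hlr.le).add
        ((hwp.intervalIntegrable_mul hpq hlr.le).const_mul 2)
    · exact hpq.intervalIntegrable_sq hlr.le
    · exact hwp.intervalIntegrable_sq hlr.le
    · exact (hwp.intervalIntegrable_mul hpq hlr.le).const_mul 2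
  have h2 : 0 ≤ ∫ x in l..r, (w x - p.eval x) ^ 2 :=
    intervalIntegral.integral_nonneg hlr.le fun x _ => sq_nonneg _
  have h3 : 0 ≤ ∫ x in l..r, (p - q).eval x ^ 2 :=
    intervalIntegral.integral_nonneg hlr.le fun x _ => sq_nonneg _
  rw [h0] at h1
  constructor <;> linarith

/-! ### Functions of fractional order -/

/-- The norms of `g` in `L²(a, b)` and in `H^θ(a, b)`, `0 ≤ θ < 1`, are at most `K`. -/
def FracBound (a b θ K : ℝ) (g : ℝ → ℝ) : Prop :=
  L2 a b g ∧ ∫ x in a..b, g x ^ 2 ≤ K ^ 2 ∧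
    (θ ≠ 0 → gagliardoSq a b θ g ≤ ENNReal.ofReal (K ^ 2))

/-- The mean value over an interval. -/
def mean (c d : ℝ) (g : ℝ → ℝ) : ℝ := (d - c)⁻¹ * ∫ x in c..d, g x

theorem gagliardoSq_mono {a b c d θ : ℝ} (hac : a ≤ c) (hdb : d ≤ b) (g : ℝ → ℝ) :
    gagliardoSq c d θ g ≤ gagliardoSq a b θ g := by
  have hs : Ioo c d ⊆ Ioo a b := Ioo_subset_Ioo hac hdb
  refine (lintegral_mono_set hs).trans (lintegral_mono fun x => lintegral_mono_set hs)

theorem ofReal_intervalIntegral {c d : ℝ} (hcd : c ≤ d) {f : ℝ → ℝ}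
    (hf : IntervalIntegrable f volume c d) (h0 : ∀ x, 0 ≤ f x) :
    ENNReal.ofReal (∫ x in c..d, f x) = ∫⁻ x in Ioo c d, ENNReal.ofReal (f x) := by
  rw [intervalIntegral.integral_of_le hcd, integral_Ioc_eq_integral_Ioo]
  rw [intervalIntegrable_iff_integrableOn_Ioo_of_le hcd] at hf
  exact ofReal_integral_eq_lintegral_ofReal hf (Filter.Eventually.of_forall h0)

/-- The Poincaré inequality of fractional order. -/
theorem fractional_poincare {c d θ : ℝ} (hcd : c < d) (hθ : 0 ≤ θ) {g : ℝ → ℝ} (hg : L2 c d g) :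
    ENNReal.ofReal (∫ x in c..d, (g x - mean c d g) ^ 2)
      ≤ ENNReal.ofReal ((d - c) ^ (2 * θ)) * gagliardoSq c d θ g := by
  have hl : 0 < d - c := sub_pos.2 hcd
  have hconst : ∀ r : ℝ, L2 c d (fun _ => r) := fun r => .of_continuousOn continuousOn_const
  have hgm : L2 c d (fun x => g x - mean c d g) := hg.sub (hconst _)
  rw [ofReal_intervalIntegral hcd.le (hgm.intervalIntegrable_sq hcd.le) fun x => sq_nonneg _,
    gagliardoSq, ← lintegral_const_mul' _ _ ENNReal.ofReal_ne_top]
  refine setLIntegral_mono' measurableSet_Ioo fun x hx => ?_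
  have hgx : L2 c d (fun y => g x - g y) := (hconst (g x)).sub hg
  have h1 : (g x - mean c d g) ^ 2 ≤ (d - c)⁻¹ * ∫ y in c..d, (g x - g y) ^ 2 := by
    have h2 := hgx.sq_integral_le hcd.le
    rw [intervalIntegral.integral_sub intervalIntegrable_const (hg.intervalIntegrable hcd.le),
      intervalIntegral.integral_const, smul_eq_mul] at h2
    have h3 : g x - mean c d g = (d - c)⁻¹ * ((d - c) * g x - ∫ y in c..d, g y) := by
      rw [mean]; field_simp
    rw [h3, mul_pow]
    calc (d - c)⁻¹ ^ 2 * ((d - c) * g x - ∫ y in c..d, g y) ^ 2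
        ≤ (d - c)⁻¹ ^ 2 * ((d - c) * ∫ y in c..d, (g x - g y) ^ 2) := by gcongr
      _ = _ := by field_simp
  refine (ENNReal.ofReal_le_ofReal h1).trans ?_
  rw [ENNReal.ofReal_mul (inv_nonneg.2 hl.le),
    ofReal_intervalIntegral hcd.le (hgx.intervalIntegrable_sq hcd.le) fun x => sq_nonneg _,
    ← lintegral_const_mul' _ _ ENNReal.ofReal_ne_top,
    ← lintegral_const_mul' _ _ ENNReal.ofReal_ne_top]
  refine setLIntegral_mono' measurableSet_Ioo fun y hy => ?_
  rw [← ENNReal.ofReal_mul (inv_nonneg.2 hl.le), ← ENNReal.ofReal_mul (by positivity)]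
  refine ENNReal.ofReal_le_ofReal ?_
  rcases eq_or_ne x y with rfl | hxy
  · simp
  have hd : 0 < |x - y| := abs_pos.2 (sub_ne_zero.2 hxy)
  have hle : |x - y| ≤ d - c := by
    rw [abs_le]; constructor <;> linarith [hx.1, hx.2, hy.1, hy.2]
  have hp : |x - y| ^ (1 + 2 * θ) ≤ (d - c) ^ (2 * θ) * (d - c) := by
    refine (Real.rpow_le_rpow hd.le hle (by positivity)).trans_eq ?_
    rw [add_comm, Real.rpow_add hl, Real.rpow_one]
  rw [sq_abs, inv_mul_eq_div, mul_div_assoc', div_le_div_iff₀ hl (by positivity)]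
  calc (g x - g y) ^ 2 * |x - y| ^ (1 + 2 * θ)
      ≤ (g x - g y) ^ 2 * ((d - c) ^ (2 * θ) * (d - c)) := by gcongr
    _ = _ := by ring

namespace FracBound

variable {a b c d θ K : ℝ} {g : ℝ → ℝ}

theorem abs (h : FracBound a b θ K g) : FracBound a b θ K (fun x => |g x|) := by
  refine ⟨h.1.abs, by simpa only [sq_abs] using h.2.1, fun hθ => le_trans ?_ (h.2.2 hθ)⟩
  refine lintegral_mono fun x => lintegral_mono fun y => ENNReal.ofReal_le_ofReal ?_
  gcongr ?_ ^ 2 / _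
  exact abs_abs_sub_abs_le_abs_sub _ _

theorem intervalIntegral_sq_le (h : FracBound a b θ K g) (hac : a ≤ c) (hcd : c ≤ d) (hdb : d ≤ b) :
    ∫ x in c..d, g x ^ 2 ≤ K ^ 2 :=
  le_trans (intervalIntegral.integral_mono_interval hac hcd hdb
    (Filter.Eventually.of_forall fun _ => sq_nonneg _)
    (h.1.intervalIntegrable_sq (hac.trans (hcd.trans hdb)))) h.2.1

theorem poincare (h : FracBound a b θ K g) (hθ : 0 < θ) (hac : a ≤ c) (hcd : c < d) (hdb : d ≤ b) :
    ∫ x in c..d, (g x - mean c d g) ^ 2 ≤ (d - c) ^ (2 * θ) * K ^ 2 := by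
  have hl : 0 < d - c := sub_pos.2 hcd
  have h1 := fractional_poincare hcd hθ.le (h.1.mono hac hdb)
  have h2 : gagliardoSq c d θ g ≤ ENNReal.ofReal (K ^ 2) :=
    (gagliardoSq_mono hac hdb g).trans (h.2.2 hθ.ne')
  have h3 := h1.trans (mul_le_mul_right h2 _)
  rw [← ENNReal.ofReal_mul (by positivity)] at h3
  exact (ENNReal.ofReal_le_ofReal_iff (by positivity)).1 h3

theorem integral_le_sqrt (h : FracBound a b θ K g) (hK : 0 ≤ K) (hac : a ≤ c) (hcd : c < d)
    (hdb : d ≤ b) : ∫ x in c..d, g x ≤ K * (d - c) ^ (1 / 2 : ℝ) := by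
  have hl : 0 < d - c := sub_pos.2 hcd
  have h1 := (h.1.mono hac hdb).sq_integral_le hcd.le
  have h2 := h.intervalIntegral_sq_le hac hcd.le hdb
  refine le_of_sq_le_sq ?_ (by positivity)
  rw [mul_pow, ← Real.rpow_natCast ((d - c) ^ (1 / 2 : ℝ)), ← Real.rpow_mul hl.le]
  norm_num
  nlinarith

/-- The integral of a function in `H^θ` over an interval is small with the interval: the exponent
`(1 + θ) / 2` is better than both `1 / 2` and `θ`. -/
theorem exists_integral_le (hab : a < b) (hθ : 0 ≤ θ) (hθ1 : θ < 1) :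
    ∃ C : ℝ, 0 < C ∧ ∀ (g : ℝ → ℝ) (K c d : ℝ), 0 ≤ K → FracBound a b θ K g → a ≤ c → c < d →
      d ≤ b → ∫ x in c..d, g x ≤ C * K * (d - c) ^ ((1 + θ) / 2) := by
  rcases hθ.eq_or_lt with rfl | hθ
  · refine ⟨1, one_pos, fun g K c d hK h hac hcd hdb => ?_⟩
    simpa using h.integral_le_sqrt hK hac hcd hdb
  set L := b - a with hL
  have hLpos : 0 < L := sub_pos.2 hab
  set ρ : ℝ := 2 ^ (-((1 - θ) / 2)) with hρ
  have hρ1 : ρ < 1 := Real.rpow_lt_one_of_one_lt_of_neg (by norm_num) (by linarith)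
  set C' : ℝ := 2 ^ θ * L ^ (θ / 2) with hC'
  have hC'0 : 0 < C' := by positivity
  have hρ2 : 0 < 1 - ρ := sub_pos.2 hρ1
  refine ⟨(L / 2) ^ (-(θ / 2)) + C' / (1 - ρ), by positivity, ?_⟩
  set C := (L / 2) ^ (-(θ / 2)) + C' / (1 - ρ) with hC
  intro g K c d hK h
  have hbase : ∀ c d, a ≤ c → c < d → d ≤ b → L / 2 ≤ d - c →
      ∫ x in c..d, g x ≤ C * K * (d - c) ^ ((1 + θ) / 2) := by
    intro c d hac hcd hdb hLd
    have hl : 0 < d - c := sub_pos.2 hcd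
    refine (h.integral_le_sqrt hK hac hcd hdb).trans ?_
    have e : (d - c) ^ (1 / 2 : ℝ) = (d - c) ^ (-(θ / 2)) * (d - c) ^ ((1 + θ) / 2) := by
      rw [← Real.rpow_add hl]; congr 1; ring
    have e2 : (d - c) ^ (-(θ / 2)) ≤ C :=
      (Real.rpow_le_rpow_of_nonpos (by positivity) hLd (by linarith)).trans
        (le_add_of_nonneg_right (by positivity))
    rw [e]
    calc K * ((d - c) ^ (-(θ / 2)) * (d - c) ^ ((1 + θ) / 2))
        ≤ K * (C * (d - c) ^ ((1 + θ) / 2)) := by gcongr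
      _ = _ := by ring
  have main : ∀ n : ℕ, ∀ c d, a ≤ c → c < d → d ≤ b → L / 2 ^ n ≤ d - c →
      ∫ x in c..d, g x ≤ C * K * (d - c) ^ ((1 + θ) / 2) := by
    intro n
    induction n with
    | zero =>
      intro c d hac hcd hdb hn
      exact hbase c d hac hcd hdb (by simp at hn; linarith)
    | succ n ih =>
      intro c d hac hcd hdb hn
      rcases le_or_gt (L / 2) (d - c) with hlt | hlt
      · exact hbase c d hac hcd hdb hlt
      set l := d - c with hl
      have hlpos : 0 < l := sub_pos.2 hcd
      obtain ⟨c', d', hac', hcc', hdd', hdb', hl'⟩ :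
          ∃ c' d', a ≤ c' ∧ c' ≤ c ∧ d ≤ d' ∧ d' ≤ b ∧ d' - c' = 2 * l := by
        refine ⟨max a (c - l), max a (c - l) + 2 * l, le_max_left _ _, max_le hac (by linarith),
          ?_, ?_, by ring⟩
        · linarith [le_max_right a (c - l)]
        · rcases max_cases a (c - l) with h | h <;> rw [h.1] <;> linarith
      have hcd' : c' < d' := by linarith
      have h1 := ih c' d' hac' hcd' hdb' (by rw [hl']; rw [pow_succ] at hn; field_simp at hn ⊢; linarith)
      have h2 := h.poincare hθ hac' hcd' hdb'
      have hgL : L2 c' d' g := h.1.mono hac' hdb'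
      have hgm : L2 c' d' (fun x => g x - mean c' d' g) :=
        hgL.sub (L2.of_continuousOn continuousOn_const)
      have hgm' : L2 c d (fun x => g x - mean c' d' g) := hgm.mono hcc' hdd'
      have h3 := hgm'.sq_integral_le hcd.le
      have h4 : ∫ x in c..d, (g x - mean c' d' g) ^ 2
          ≤ ∫ x in c'..d', (g x - mean c' d' g) ^ 2 :=
        intervalIntegral.integral_mono_interval hcc' hcd.le hdd'
          (Filter.Eventually.of_forall fun _ => sq_nonneg _)
          (hgm.intervalIntegrable_sq hcd'.le)
      rw [hl'] at h1 h2
      have h5 : ∫ x in c..d, (g x - mean c' d' g) ≤ C' * K * l ^ ((1 + θ) / 2) := by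
        have h6 : ∫ x in c..d, (g x - mean c' d' g) ≤ l ^ (1 / 2 : ℝ) * (2 * l) ^ θ * K := by
          refine le_of_sq_le_sq ?_ (by positivity)
          have e1 : (l ^ (1 / 2 : ℝ)) ^ 2 = l := by
            rw [← Real.rpow_natCast (l ^ (1 / 2 : ℝ)), ← Real.rpow_mul hlpos.le]; norm_num
          have e2 : ((2 * l) ^ θ) ^ 2 = (2 * l) ^ (2 * θ) := by
            rw [← Real.rpow_natCast ((2 * l) ^ θ), ← Real.rpow_mul (by positivity), mul_comm θ]
            norm_num
          rw [mul_pow, mul_pow, e1, e2]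
          calc _ ≤ l * ((2 * l) ^ (2 * θ) * K ^ 2) :=
                h3.trans (mul_le_mul_of_nonneg_left (h4.trans h2) hlpos.le)
            _ = _ := by ring
        refine h6.trans ?_
        have e : l ^ (1 / 2 : ℝ) * (2 * l) ^ θ = 2 ^ θ * l ^ (θ / 2) * l ^ ((1 + θ) / 2) := by
          rw [Real.mul_rpow (by norm_num) hlpos.le, mul_assoc, ← Real.rpow_add hlpos,
            mul_left_comm, ← Real.rpow_add hlpos]
          congr 2; ring
        have e3 : l ^ (θ / 2) ≤ L ^ (θ / 2) :=
          Real.rpow_le_rpow hlpos.le (by linarith) (by positivity)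
        rw [e, hC']
        calc 2 ^ θ * l ^ (θ / 2) * l ^ ((1 + θ) / 2) * K
            ≤ 2 ^ θ * L ^ (θ / 2) * l ^ ((1 + θ) / 2) * K := by gcongr
          _ = _ := by ring
      have h7 : l * mean c' d' g ≤ ρ * (C * K * l ^ ((1 + θ) / 2)) := by
        have e : (2 * l) ^ ((1 + θ) / 2) = 2 * ρ * l ^ ((1 + θ) / 2) := by
          rw [Real.mul_rpow (by norm_num) hlpos.le, hρ]
          congr 1
          rw [show (2 : ℝ) * 2 ^ (-((1 - θ) / 2)) = 2 ^ (1 : ℝ) * 2 ^ (-((1 - θ) / 2)) by simp,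
            ← Real.rpow_add (by norm_num)]
          congr 1; ring
        rw [mean, hl']
        rw [e] at h1
        calc l * ((2 * l)⁻¹ * ∫ x in c'..d', g x) = 1 / 2 * ∫ x in c'..d', g x := by
              field_simp
          _ ≤ 1 / 2 * (C * K * (2 * ρ * l ^ ((1 + θ) / 2))) := by gcongr
          _ = _ := by ring
      have h8 : ∫ x in c..d, g x = (∫ x in c..d, (g x - mean c' d' g)) + l * mean c' d' g := by
        rw [intervalIntegral.integral_sub ((hgL.mono hcc' hdd').intervalIntegrable hcd.le)
          intervalIntegrable_const, intervalIntegral.integral_const, smul_eq_mul]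
        ring
      have h9 : C' + ρ * C ≤ C := by
        have : C' ≤ C * (1 - ρ) := by
          rw [hC, add_mul, div_mul_cancel₀ _ hρ2.ne']
          have : 0 ≤ (L / 2) ^ (-(θ / 2)) * (1 - ρ) := by positivity
          linarith
        linarith
      rw [h8]
      calc _ ≤ C' * K * l ^ ((1 + θ) / 2) + ρ * (C * K * l ^ ((1 + θ) / 2)) := add_le_add h5 h7
        _ = (C' + ρ * C) * (K * l ^ ((1 + θ) / 2)) := by ring
        _ ≤ C * (K * l ^ ((1 + θ) / 2)) := by gcongr
        _ = _ := by ring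
  intro hac hcd hdb
  obtain ⟨n, hn⟩ := exists_pow_lt_of_lt_one (show 0 < (d - c) / L from div_pos (sub_pos.2 hcd) hLpos)
    (show (1 / 2 : ℝ) < 1 by norm_num)
  refine main n c d hac hcd hdb ?_
  rw [lt_div_iff₀ hLpos] at hn
  calc L / 2 ^ n = (1 / 2) ^ n * L := by rw [one_div, inv_pow]; ring
    _ ≤ _ := hn.le

end FracBound

theorem exists_lintegral_abs_rpow_le (a b : ℝ) {θ : ℝ} (hθ1 : θ < 1) :
    ∃ C : ℝ, 0 ≤ C ∧ ∀ x ∈ Ioo a b,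
      ∫⁻ y in Ioo a b, ENNReal.ofReal (|x - y| ^ (-θ)) ≤ ENNReal.ofReal C := by
  set L := b - a with hL
  set F : ℝ → ℝ≥0∞ := fun z => ENNReal.ofReal (|z| ^ (-θ)) with hF
  have h1 : IntervalIntegrable (fun z : ℝ => |z| ^ (-θ)) volume 0 L := by
    have h := (intervalIntegral.intervalIntegrable_rpow' (a := 0) (b := |L|)
      (show -1 < -θ by linarith)).congr (g := fun z : ℝ => |z| ^ (-θ)) (by
        intro z hz
        rw [uIoc_of_le (abs_nonneg _)] at hz
        simp only [abs_of_pos hz.1])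
    rcases le_total 0 L with hL | hL
    · rwa [abs_of_nonneg hL] at h
    · rw [abs_of_nonpos hL] at h
      rw [IntervalIntegrable.iff_comp_neg]; simpa using h
  have h2 : IntervalIntegrable (fun z : ℝ => |z| ^ (-θ)) volume (-L) 0 := by
    rw [IntervalIntegrable.iff_comp_neg]; simpa using h1.symm
  have h3 := h2.trans h1
  refine ⟨(∫⁻ z in Ioo (-L) L, F z).toReal, ENNReal.toReal_nonneg, fun x hx => ?_⟩
  have hLpos : 0 < L := by linarith [hx.1, hx.2]
  have hfin : ∫⁻ z in Ioo (-L) L, F z ≠ ∞ := by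
    rw [intervalIntegrable_iff_integrableOn_Ioo_of_le (by linarith)] at h3
    have h4 := h3.2
    rw [hasFiniteIntegral_iff_ofReal (Filter.Eventually.of_forall fun z => by
      show 0 ≤ |z| ^ (-θ)
      positivity)] at h4
    exact h4.ne
  rw [ENNReal.ofReal_toReal hfin, ← lintegral_indicator measurableSet_Ioo,
    ← lintegral_indicator measurableSet_Ioo,
    ← lintegral_sub_left_eq_self ((Ioo (-L) L).indicator F) x]
  refine lintegral_mono fun y => ?_
  by_cases hy : y ∈ Ioo a b
  · rw [indicator_of_mem hy, indicator_of_mem]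
    constructor <;> linarith [hx.1, hx.2, hy.1, hy.2]
  · rw [indicator_of_notMem hy]
    exact zero_le

theorem aemeasurable_gagliardo {a b θ : ℝ} {g : ℝ → ℝ} (hg : L2 a b g) :
    AEMeasurable (fun p : ℝ × ℝ =>
      ENNReal.ofReal (|g p.1 - g p.2| ^ 2 / |p.1 - p.2| ^ (1 + 2 * θ)))
      ((volume.restrict (Ioo a b)).prod (volume.restrict (Ioo a b))) := by
  have h1 : AEMeasurable (fun p : ℝ × ℝ => g p.1)
      ((volume.restrict (Ioo a b)).prod (volume.restrict (Ioo a b))) := hg.1.aemeasurable.comp_fst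
  have h2 : AEMeasurable (fun p : ℝ × ℝ => g p.2)
      ((volume.restrict (Ioo a b)).prod (volume.restrict (Ioo a b))) := hg.1.aemeasurable.comp_snd
  have h3 : Measurable (fun p : ℝ × ℝ => |p.1 - p.2| ^ (1 + 2 * θ)) := by fun_prop
  have h4 : AEMeasurable (fun p : ℝ × ℝ => |g p.1 - g p.2| ^ 2)
      ((volume.restrict (Ioo a b)).prod (volume.restrict (Ioo a b))) := by
    simp only [sq_abs]
    exact (h1.sub h2).pow_const 2
  exact (h4.div h3.aemeasurable).ennreal_ofReal

theorem gagliardoSq_le_add {a b θ A : ℝ} {g h : ℝ → ℝ} {R : ℝ → ℝ → ℝ≥0∞} (hg : L2 a b g)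
    (H : ∀ x ∈ Ioo a b, ∀ y ∈ Ioo a b, ENNReal.ofReal (|h x - h y| ^ 2 / |x - y| ^ (1 + 2 * θ)) ≤
      ENNReal.ofReal A * ENNReal.ofReal (|g x - g y| ^ 2 / |x - y| ^ (1 + 2 * θ)) + R x y) :
    gagliardoSq a b θ h ≤ ENNReal.ofReal A * gagliardoSq a b θ g +
      ∫⁻ x in Ioo a b, ∫⁻ y in Ioo a b, R x y := by
  have hm := aemeasurable_gagliardo (θ := θ) hg
  rw [gagliardoSq, gagliardoSq, ← lintegral_const_mul' _ _ ENNReal.ofReal_ne_top,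
    ← lintegral_add_left' (hm.lintegral_prod_right'.const_mul _)]
  refine setLIntegral_mono' measurableSet_Ioo fun x hx => ?_
  have hmx : AEMeasurable (fun y =>
      ENNReal.ofReal (|g x - g y| ^ 2 / |x - y| ^ (1 + 2 * θ))) (volume.restrict (Ioo a b)) := by
    have h3 : Measurable (fun y : ℝ => |x - y| ^ (1 + 2 * θ)) := by fun_prop
    simp only [sq_abs]
    exact (((aemeasurable_const.sub hg.1.aemeasurable).pow_const 2).div
      h3.aemeasurable).ennreal_ofReal
  rw [← lintegral_const_mul' _ _ ENNReal.ofReal_ne_top, ← lintegral_add_left' (hmx.const_mul _)]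
  exact setLIntegral_mono' measurableSet_Ioo fun y hy => H x hx y hy

/-- `w` is bounded by `K` and is a primitive of a function with norm at most `K`, which is `n` times
iterated: the norm of `w` in `H^(n+θ)(a, b)` is controlled by `K`. -/
def SobBound (a b θ : ℝ) : ℕ → ℝ → (ℝ → ℝ) → Prop
  | 0, K, w => FracBound a b θ K w
  | n + 1, K, w => (∀ x ∈ Icc a b, |w x| ≤ K) ∧ ∃ g, SobBound a b θ n K g ∧ IsPrim a b w g

section

variable {a b θ K K' : ℝ}

theorem FracBound.mono_const {g : ℝ → ℝ} (h : FracBound a b θ K g) (hK : 0 ≤ K) (hKK' : K ≤ K') :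
    FracBound a b θ K' g := by
  have : K ^ 2 ≤ K' ^ 2 := by gcongr
  exact ⟨h.1, h.2.1.trans this, fun hθ => (h.2.2 hθ).trans (ENNReal.ofReal_le_ofReal this)⟩

theorem SobBound.mono_const {n : ℕ} {w : ℝ → ℝ} (h : SobBound a b θ n K w) (hK : 0 ≤ K)
    (hKK' : K ≤ K') : SobBound a b θ n K' w := by
  induction n generalizing w with
  | zero => exact FracBound.mono_const h hK hKK'
  | succ n ih =>
    obtain ⟨h1, g, hg, hp⟩ := h
    exact ⟨fun x hx => (h1 x hx).trans hKK', g, ih hg, hp⟩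

theorem FracBound.add {K₁ K₂ : ℝ} {w v : ℝ → ℝ} (hab : a ≤ b) (hw : FracBound a b θ K₁ w)
    (hv : FracBound a b θ K₂ v) (h1 : 0 ≤ K₁) (h2 : 0 ≤ K₂) :
    FracBound a b θ (2 * (K₁ + K₂)) (fun x => w x + v x) := by
  have hi : ∀ s t : ℝ, (s + t) ^ 2 ≤ 2 * s ^ 2 + 2 * t ^ 2 := fun s t => by
    nlinarith [sq_nonneg (s - t)]
  have hK : 2 * K₁ ^ 2 + 2 * K₂ ^ 2 ≤ (2 * (K₁ + K₂)) ^ 2 := by nlinarith [mul_nonneg h1 h2]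
  have hadd : L2 a b (fun x => w x + v x) := hw.1.add hv.1
  refine ⟨hadd, ?_, fun hθ => ?_⟩
  · refine le_trans ?_ hK
    calc ∫ x in a..b, (w x + v x) ^ 2 ≤ ∫ x in a..b, (2 * w x ^ 2 + 2 * v x ^ 2) :=
          intervalIntegral.integral_mono_on hab (hadd.intervalIntegrable_sq hab)
            (((hw.1.intervalIntegrable_sq hab).const_mul _).add
              ((hv.1.intervalIntegrable_sq hab).const_mul _)) fun x _ => hi _ _
      _ = 2 * (∫ x in a..b, w x ^ 2) + 2 * ∫ x in a..b, v x ^ 2 := by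
          rw [intervalIntegral.integral_add ((hw.1.intervalIntegrable_sq hab).const_mul _)
              ((hv.1.intervalIntegrable_sq hab).const_mul _),
            intervalIntegral.integral_const_mul, intervalIntegral.integral_const_mul]
      _ ≤ _ := by linarith [hw.2.1, hv.2.1]
  · have h := gagliardoSq_le_add (θ := θ) hw.1 (A := 2) (h := fun x => w x + v x)
      (R := fun x y => ENNReal.ofReal 2 *
        ENNReal.ofReal (|v x - v y| ^ 2 / |x - y| ^ (1 + 2 * θ))) (fun x _ y _ => by
        rw [← ENNReal.ofReal_mul (by norm_num), ← ENNReal.ofReal_mul (by norm_num),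
          ← ENNReal.ofReal_add (by positivity) (by positivity)]
        refine ENNReal.ofReal_le_ofReal ?_
        rw [mul_div_assoc', mul_div_assoc', ← add_div]
        gcongr
        simp only [sq_abs]
        have := hi (w x - w y) (v x - v y)
        rw [show w x + v x - (w y + v y) = w x - w y + (v x - v y) by ring]
        exact this)
    refine h.trans ?_
    simp only [lintegral_const_mul' _ _ ENNReal.ofReal_ne_top]
    refine (add_le_add (mul_le_mul_right (hw.2.2 hθ) _) (mul_le_mul_right (hv.2.2 hθ) _)).trans ?_
    rw [← ENNReal.ofReal_mul (by norm_num), ← ENNReal.ofReal_mul (by norm_num),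
      ← ENNReal.ofReal_add (by positivity) (by positivity)]
    exact ENNReal.ofReal_le_ofReal hK

theorem SobBound.add {n : ℕ} {K₁ K₂ : ℝ} {w v : ℝ → ℝ} (hab : a ≤ b) (hw : SobBound a b θ n K₁ w)
    (hv : SobBound a b θ n K₂ v) (h1 : 0 ≤ K₁) (h2 : 0 ≤ K₂) :
    SobBound a b θ n (2 * (K₁ + K₂)) (fun x => w x + v x) := by
  induction n generalizing w v with
  | zero => exact FracBound.add hab hw hv h1 h2
  | succ n ih =>
    obtain ⟨hw1, g, hg, hp⟩ := hw
    obtain ⟨hv1, g', hg', hp'⟩ := hv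
    refine ⟨fun x hx => ?_, _, ih hg hg', hp.add hp'⟩
    refine (abs_add_le _ _).trans ?_
    linarith [hw1 x hx, hv1 x hx]

theorem SobBound.continuousOn {n : ℕ} {w : ℝ → ℝ} (h : SobBound a b θ (n + 1) K w) :
    ContinuousOn w (Icc a b) := by
  obtain ⟨-, g, -, hp⟩ := h
  exact hp.continuousOn

theorem SobBound.l2 {n : ℕ} {w : ℝ → ℝ} (h : SobBound a b θ n K w) : L2 a b w := by
  cases n with
  | zero => exact h.1
  | succ n => exact .of_continuousOn h.continuousOn

/-- A function with derivative in `H^θ` is Hölder continuous with exponent `(1 + θ) / 2`. -/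
theorem SobBound.exists_holder (hab : a < b) (hθ : 0 ≤ θ) (hθ1 : θ < 1) :
    ∃ C : ℝ, 0 < C ∧ ∀ (K : ℝ) (v : ℝ → ℝ), 0 ≤ K → SobBound a b θ 1 K v →
      ∀ x ∈ Icc a b, ∀ y ∈ Icc a b, |v x - v y| ≤ C * K * |x - y| ^ ((1 + θ) / 2) := by
  obtain ⟨C, hC, H⟩ := FracBound.exists_integral_le hab hθ hθ1
  refine ⟨C, hC, fun K v hK h => ?_⟩
  obtain ⟨-, g, hg, hp⟩ := h
  have key : ∀ x ∈ Icc a b, ∀ y ∈ Icc a b, x < y →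
      |v y - v x| ≤ C * K * (y - x) ^ ((1 + θ) / 2) := by
    intro x hx y hy hxy
    rw [hp.sub_eq hx hy]
    exact (intervalIntegral.abs_integral_le_integral_abs hxy.le).trans
      (H _ K x y hK (FracBound.abs hg) hx.1 hxy hy.2)
  intro x hx y hy
  rcases lt_trichotomy x y with hxy | rfl | hxy
  · rw [abs_sub_comm, abs_sub_comm x, abs_of_pos (sub_pos.2 hxy)]
    exact key x hx y hy hxy
  · simp only [sub_self, abs_zero]
    positivity
  · rw [abs_of_pos (sub_pos.2 hxy)]
    exact key y hy x hx hxy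

/-- Functions in `H^(1+θ)` are multipliers of `H^θ`. -/
theorem FracBound.exists_mul (hab : a < b) (hθ : 0 ≤ θ) (hθ1 : θ < 1) :
    ∃ C : ℝ, 0 < C ∧ ∀ (K L : ℝ) (g v : ℝ → ℝ), 0 ≤ K → 0 ≤ L → FracBound a b θ K g →
      SobBound a b θ 1 L v → FracBound a b θ (C * (K * L)) (fun x => g x * v x) := by
  obtain ⟨C₀, hC₀, H⟩ := SobBound.exists_holder hab hθ hθ1
  obtain ⟨C₁, hC₁, H1⟩ := exists_lintegral_abs_rpow_le a b hθ1
  refine ⟨2 + 2 * C₀ ^ 2 * C₁, by positivity, fun K L g v hK hL hg hv => ?_⟩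
  set C := 2 + 2 * C₀ ^ 2 * C₁ with hC
  have hC1 : 1 ≤ C := by have : 0 ≤ 2 * C₀ ^ 2 * C₁ := by positivity
                         linarith
  have hvL : ∀ x ∈ Icc a b, |v x| ≤ L := hv.1
  have hvc := hv.continuousOn
  have hCsq : C * (K * L) ^ 2 ≤ (C * (K * L)) ^ 2 := by
    rw [mul_pow C]
    exact mul_le_mul_of_nonneg_right (le_self_pow₀ hC1 two_ne_zero) (sq_nonneg _)
  have hgv : L2 a b (fun x => g x * v x) := by
    refine hg.1.of_le_mul (c := L) (hg.1.1.mul ((hvc.mono Ioo_subset_Icc_self).aestronglyMeasurable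
      measurableSet_Ioo)) ?_
    filter_upwards [ae_restrict_mem measurableSet_Ioo] with x hx
    rw [Real.norm_eq_abs, abs_mul, mul_comm, Real.norm_eq_abs]
    gcongr
    exact hvL x (Ioo_subset_Icc_self hx)
  refine ⟨hgv, le_trans ?_ hCsq, fun hθ0 => ?_⟩
  · calc ∫ x in a..b, (g x * v x) ^ 2 ≤ ∫ x in a..b, g x ^ 2 * L ^ 2 := by
          refine intervalIntegral.integral_mono_on hab.le (hgv.intervalIntegrable_sq hab.le)
            ((hg.1.intervalIntegrable_sq hab.le).mul_const _) fun x hx => ?_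
          rw [mul_pow]
          gcongr ?_ * ?_
          exact sq_le_sq.2 ((hvL x hx).trans (le_abs_self L))
      _ = (∫ x in a..b, g x ^ 2) * L ^ 2 := intervalIntegral.integral_mul_const _ _
      _ ≤ K ^ 2 * L ^ 2 := by gcongr; exact hg.2.1
      _ = 1 * (K * L) ^ 2 := by ring
      _ ≤ C * (K * L) ^ 2 := by gcongr
  · have h := gagliardoSq_le_add (θ := θ) hg.1 (A := 2 * L ^ 2)
      (h := fun x => g x * v x)
      (R := fun x y => ENNReal.ofReal (2 * g x ^ 2 * (C₀ * L) ^ 2) *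
        ENNReal.ofReal (|x - y| ^ (-θ))) (fun x hx y hy => by
        rw [← ENNReal.ofReal_mul (by positivity), ← ENNReal.ofReal_mul (by positivity),
          ← ENNReal.ofReal_add (by positivity) (by positivity)]
        refine ENNReal.ofReal_le_ofReal ?_
        rcases eq_or_ne x y with rfl | hxy
        · simp only [sub_self, abs_zero]
          simp
          positivity
        have hd : 0 < |x - y| := abs_pos.2 (sub_ne_zero.2 hxy)
        have hx' := Ioo_subset_Icc_self hx
        have hy' := Ioo_subset_Icc_self hy
        have e : |x - y| ^ (-θ) = (|x - y| ^ ((1 + θ) / 2)) ^ 2 / |x - y| ^ (1 + 2 * θ) := by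
          rw [← Real.rpow_natCast (|x - y| ^ ((1 + θ) / 2)), ← Real.rpow_mul hd.le,
            ← Real.rpow_sub hd]
          congr 1; push_cast; ring
        rw [e, mul_div_assoc', mul_div_assoc', ← add_div]
        gcongr
        simp only [sq_abs]
        have h1 : (v x - v y) ^ 2 ≤ (C₀ * L) ^ 2 * (|x - y| ^ ((1 + θ) / 2)) ^ 2 := by
          rw [← mul_pow, ← sq_abs]
          gcongr
          exact H L v hL hv x hx' y hy'
        have h2 : v y ^ 2 ≤ L ^ 2 := sq_le_sq.2 ((hvL y hy').trans (le_abs_self L))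
        calc (g x * v x - g y * v y) ^ 2 = ((g x - g y) * v y + g x * (v x - v y)) ^ 2 := by ring
          _ ≤ 2 * ((g x - g y) ^ 2 * v y ^ 2) + 2 * (g x ^ 2 * (v x - v y) ^ 2) := by
              nlinarith [sq_nonneg ((g x - g y) * v y - g x * (v x - v y))]
          _ ≤ 2 * ((g x - g y) ^ 2 * L ^ 2) + 2 * (g x ^ 2 *
                ((C₀ * L) ^ 2 * (|x - y| ^ ((1 + θ) / 2)) ^ 2)) := by gcongr
          _ = _ := by ring)
    refine h.trans ?_
    have h2 : ∫⁻ x in Ioo a b, ∫⁻ y in Ioo a b, ENNReal.ofReal (2 * g x ^ 2 * (C₀ * L) ^ 2) *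
        ENNReal.ofReal (|x - y| ^ (-θ)) ≤ ENNReal.ofReal (2 * C₀ ^ 2 * C₁ * (K * L) ^ 2) := by
      simp only [lintegral_const_mul' _ _ ENNReal.ofReal_ne_top]
      calc _ ≤ ∫⁻ x in Ioo a b, ENNReal.ofReal (2 * (C₀ * L) ^ 2 * C₁) *
            ENNReal.ofReal (g x ^ 2) := by
            refine setLIntegral_mono' measurableSet_Ioo fun x hx => ?_
            refine (mul_le_mul_right (H1 x hx) _).trans_eq ?_
            rw [← ENNReal.ofReal_mul (by positivity), ← ENNReal.ofReal_mul (by positivity)]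
            congr 1; ring
        _ = ENNReal.ofReal (2 * (C₀ * L) ^ 2 * C₁) * ENNReal.ofReal (∫ x in a..b, g x ^ 2) := by
            rw [lintegral_const_mul' _ _ ENNReal.ofReal_ne_top, ofReal_intervalIntegral hab.le
              (hg.1.intervalIntegrable_sq hab.le) fun x => sq_nonneg _]
        _ ≤ _ := by
            rw [← ENNReal.ofReal_mul (by positivity)]
            refine ENNReal.ofReal_le_ofReal ?_
            calc _ ≤ 2 * (C₀ * L) ^ 2 * C₁ * K ^ 2 := by gcongr; exact hg.2.1
              _ = _ := by ring
    refine (add_le_add (mul_le_mul_right (hg.2.2 hθ0) _) h2).trans ?_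
    rw [← ENNReal.ofReal_mul (by positivity), ← ENNReal.ofReal_add (by positivity) (by positivity)]
    refine ENNReal.ofReal_le_ofReal (le_trans (le_of_eq ?_) hCsq)
    rw [hC]; ring

theorem FracBound.const_one (hab : a ≤ b) : FracBound a b θ (1 + (b - a)) (fun _ => 1) := by
  refine ⟨.of_continuousOn continuousOn_const, ?_, fun _ => ?_⟩
  · simp; nlinarith
  · simp [gagliardoSq]

theorem SobBound.exists_of_succ (hab : a < b) (hθ : 0 ≤ θ) (hθ1 : θ < 1) (n : ℕ) :
    ∃ C : ℝ, 0 < C ∧ ∀ (K : ℝ) (w : ℝ → ℝ), 0 ≤ K → SobBound a b θ (n + 1) K w →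
      SobBound a b θ n (C * K) w := by
  induction n with
  | zero =>
    obtain ⟨C, hC, H⟩ := FracBound.exists_mul hab hθ hθ1
    have hL : 0 < b - a := sub_pos.2 hab
    refine ⟨C * (1 + (b - a)), by positivity, fun K w hK h => ?_⟩
    have h1 := H _ K _ w (by positivity) hK (FracBound.const_one hab.le) h
    simp only [one_mul, ← mul_assoc] at h1
    exact h1
  | succ n ih =>
    obtain ⟨C, hC, H⟩ := ih
    refine ⟨1 + C, by positivity, fun K w hK h => ?_⟩
    obtain ⟨h1, g, hg, hp⟩ := h
    have hKC : 0 ≤ C * K := by positivity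
    refine ⟨fun x hx => (h1 x hx).trans (by linarith), g, ?_, hp⟩
    exact (H K g hK hg).mono_const hKC (by linarith)

theorem SobBound.exists_mul_succ (hab : a < b) (hθ : 0 ≤ θ) (hθ1 : θ < 1) (n : ℕ) :
    ∃ C : ℝ, 0 < C ∧ ∀ (K L : ℝ) (w v : ℝ → ℝ), 0 ≤ K → 0 ≤ L → SobBound a b θ n K w →
      SobBound a b θ (n + 1) L v → SobBound a b θ n (C * (K * L)) (fun x => w x * v x) := by
  induction n with
  | zero => exact FracBound.exists_mul hab hθ hθ1
  | succ n ih =>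
    obtain ⟨C, hC, H⟩ := ih
    obtain ⟨D, hD, H'⟩ := SobBound.exists_of_succ hab hθ hθ1 (n + 1)
    obtain ⟨E, hE, H''⟩ := SobBound.exists_of_succ hab hθ hθ1 n
    refine ⟨1 + 2 * (C * D + C * E), by positivity, fun K L w v hK hL hw hv => ?_⟩
    have hv' := H' L v hL hv
    obtain ⟨hw1, w', hw', hwp⟩ := id hw
    obtain ⟨hv1, v', hv'', hvp⟩ := hv
    have hKL : 0 ≤ K * L := by positivity
    have hCKL : 0 ≤ C * D * (K * L) := by positivity
    have hCKL' : 0 ≤ C * E * (K * L) := by positivity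
    refine ⟨fun x hx => ?_, _, ?_, hwp.mul hab.le hvp⟩
    · rw [abs_mul]
      calc |w x| * |v x| ≤ K * L := mul_le_mul (hw1 x hx) (hv1 x hx) (abs_nonneg _) hK
        _ ≤ _ := by nlinarith
    · have t1 := H K (D * L) w' v hK (by positivity) hw' hv'
      have t2 := H (E * L) K v' w (by positivity) hK (H'' L v' hL hv'') hw
      have t3 := t1.add hab.le t2 (by positivity) (by positivity)
      simp only [mul_comm (v' _)] at t3
      exact t3.mono_const (by positivity) (by nlinarith)

/-- The space `H^(n+1+θ)` is an algebra. -/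
theorem SobBound.exists_mul (hab : a < b) (hθ : 0 ≤ θ) (hθ1 : θ < 1) (n : ℕ) :
    ∃ C : ℝ, 0 < C ∧ ∀ (K L : ℝ) (w v : ℝ → ℝ), 0 ≤ K → 0 ≤ L → SobBound a b θ (n + 1) K w →
      SobBound a b θ (n + 1) L v → SobBound a b θ (n + 1) (C * (K * L)) (fun x => w x * v x) := by
  obtain ⟨C, hC, H⟩ := SobBound.exists_mul_succ hab hθ hθ1 n
  refine ⟨1 + 4 * C, by positivity, fun K L w v hK hL hw hv => ?_⟩
  obtain ⟨hw1, w', hw', hwp⟩ := id hw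
  obtain ⟨hv1, v', hv', hvp⟩ := id hv
  have hKL : 0 ≤ K * L := by positivity
  refine ⟨fun x hx => ?_, _, ?_, hwp.mul hab.le hvp⟩
  · rw [abs_mul]
    calc |w x| * |v x| ≤ K * L := mul_le_mul (hw1 x hx) (hv1 x hx) (abs_nonneg _) hK
      _ ≤ _ := by nlinarith
  · have t3 := (H K L w' v hK hL hw' hv).add hab.le (H L K v' w hL hK hv' hw)
      (by positivity) (by positivity)
    simp only [mul_comm (v' _)] at t3
    exact t3.mono_const (by positivity) (by nlinarith)

end

/-! ### Weak derivatives -/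

section

variable {a b : ℝ}

theorem integrable_mul_test {v φ : ℝ → ℝ} (hv : LocallyIntegrableOn v (Ioo a b))
    (hφ : Continuous φ) (hc : HasCompactSupport φ) (hs : tsupport φ ⊆ Ioo a b) :
    Integrable (fun x => v x * φ x) := by
  have h1 : IntegrableOn (fun x => v x * φ x) (tsupport φ) :=
    (hv.integrableOn_compact_subset hs hc).mul_continuousOn hφ.continuousOn hc
  rwa [integrableOn_iff_integrable_of_support_subset] at h1
  intro x hx
  refine subset_tsupport φ ?_
  intro h0
  exact hx (by simp [h0])

theorem ae_eq_of_forall_test {v w : ℝ → ℝ} (hv : LocallyIntegrableOn v (Ioo a b))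
    (hw : LocallyIntegrableOn w (Ioo a b))
    (H : ∀ φ : ℝ → ℝ, ContDiff ℝ (⊤ : ℕ∞) φ → HasCompactSupport φ → tsupport φ ⊆ Ioo a b →
      ∫ x in Ioo a b, v x * φ x = ∫ x in Ioo a b, w x * φ x) :
    v =ᵐ[volume.restrict (Ioo a b)] w := by
  have h := isOpen_Ioo.ae_eq_zero_of_integral_contDiff_smul_eq_zero (μ := volume) (hv.sub hw) (by
    intro φ hφ hc hs
    have h1 := integrable_mul_test hv hφ.continuous hc hs
    have h2 := integrable_mul_test hw hφ.continuous hc hs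
    have h3 : ∀ x, φ x • (v - w) x = v x * φ x - w x * φ x := fun x => by
      simp only [smul_eq_mul, Pi.sub_apply]; ring
    have h4 : ∀ u : ℝ → ℝ, ∫ x in Ioo a b, u x * φ x = ∫ x, u x * φ x := by
      intro u
      refine setIntegral_eq_integral_of_forall_compl_eq_zero fun x hx => ?_
      rw [image_eq_zero_of_notMem_tsupport fun h => hx (hs h), mul_zero]
    simp_rw [h3]
    rw [integral_sub h1 h2, ← h4, ← h4, H φ hφ hc hs, sub_self])
  rw [Filter.EventuallyEq, ae_restrict_iff' measurableSet_Ioo]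
  filter_upwards [h] with x hx hxI
  exact sub_eq_zero.1 (hx hxI)

namespace IsWeakDeriv

variable {m : ℕ} {u v g g' : ℝ → ℝ}

theorem unique (h : IsWeakDeriv a b m u g) (h' : IsWeakDeriv a b m u g') :
    g =ᵐ[volume.restrict (Ioo a b)] g' := by
  refine ae_eq_of_forall_test h.2.1 h'.2.1 fun φ hφ hc hs => ?_
  have h1 := h.2.2 φ hφ hc hs
  rw [h'.2.2 φ hφ hc hs] at h1
  have h2 : (-1 : ℝ) ^ m ≠ 0 := pow_ne_zero _ (by norm_num)
  exact (mul_left_cancel₀ h2 h1).symm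

theorem congr_left (h : IsWeakDeriv a b m u g) (huv : u =ᵐ[volume.restrict (Ioo a b)] v) :
    IsWeakDeriv a b m v g := by
  refine ⟨h.1.congr huv, h.2.1, fun φ hφ hc hs => ?_⟩
  rw [← h.2.2 φ hφ hc hs]
  refine integral_congr_ae ?_
  filter_upwards [huv] with x hx
  rw [hx]

theorem succ (h : IsWeakDeriv a b m u g) (h' : IsWeakDeriv a b (m + 1) u g') :
    IsWeakDeriv a b 1 g g' := by
  refine ⟨h.2.1, h'.2.1, fun φ hφ hc hs => ?_⟩
  have hφ' : ContDiff ℝ (⊤ : ℕ∞) (deriv φ) := (contDiff_infty_iff_deriv.1 hφ).2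
  have h1 := h.2.2 (deriv φ) hφ' hc.deriv ((tsupport_deriv_subset (𝕜 := ℝ)).trans hs)
  have h2 := h'.2.2 φ hφ hc hs
  rw [iteratedDeriv_succ', h1, pow_succ, mul_assoc] at h2
  have h3 : (-1 : ℝ) ^ m ≠ 0 := pow_ne_zero _ (by norm_num)
  rw [iteratedDeriv_one, pow_one]
  exact mul_left_cancel₀ h3 h2

end IsWeakDeriv

theorem tsupport_endpoints {φ : ℝ → ℝ} (hs : tsupport φ ⊆ Ioo a b) : φ a = 0 ∧ φ b = 0 :=
  ⟨image_eq_zero_of_notMem_tsupport fun h => (hs h).1.false,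
    image_eq_zero_of_notMem_tsupport fun h => (hs h).2.false⟩

theorem L2.locallyIntegrableOn {f : ℝ → ℝ} (h : L2 a b f) : LocallyIntegrableOn f (Ioo a b) :=
  IntegrableOn.locallyIntegrableOn (h.integrable (by norm_num))

theorem IsPrim.isWeakDeriv {w g : ℝ → ℝ} (hab : a < b) (h : IsPrim a b w g) :
    IsWeakDeriv a b 1 w g := by
  have hg : IntegrableOn g (Ioo a b) := by
    rw [← intervalIntegrable_iff_integrableOn_Ioo_of_le hab.le]; exact h.1
  refine ⟨(L2.of_continuousOn h.continuousOn).locallyIntegrableOn, hg.locallyIntegrableOn,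
    fun φ hφ hc hs => ?_⟩
  have hφd : ContDiff ℝ (⊤ : ℕ∞) (deriv φ) := (contDiff_infty_iff_deriv.1 hφ).2
  have hφp : IsPrim a b φ (deriv φ) := IsPrim.of_deriv
    (fun x => ((contDiff_infty_iff_deriv.1 hφ).1 x).hasDerivAt) hφd.continuous a b
  have h1 := h.parts hab.le hφp
  rw [(tsupport_endpoints hs).1, (tsupport_endpoints hs).2] at h1
  simp only [← integral_Ioc_eq_integral_Ioo, ← intervalIntegral.integral_of_le hab.le,
    iteratedDeriv_one]
  linarith

theorem exists_test_primitive {ψ : ℝ → ℝ} (hψ : ContDiff ℝ (⊤ : ℕ∞) ψ)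
    (hc : HasCompactSupport ψ) (hs : tsupport ψ ⊆ Ioo a b) (h0 : ∫ x in a..b, ψ x = 0) :
    ∃ φ : ℝ → ℝ, ContDiff ℝ (⊤ : ℕ∞) φ ∧ HasCompactSupport φ ∧ tsupport φ ⊆ Ioo a b ∧
      deriv φ = ψ := by
  have hcont := hψ.continuous
  have hd : ∀ x, HasDerivAt (fun x => ∫ t in a..x, ψ t) (ψ x) x := fun x =>
    intervalIntegral.integral_hasDerivAt_right (hcont.intervalIntegrable _ _)
      hcont.stronglyMeasurable.stronglyMeasurableAtFilter hcont.continuousAt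
  have hderiv : deriv (fun x => ∫ t in a..x, ψ t) = ψ := funext fun x => (hd x).deriv
  have hcd : ContDiff ℝ (⊤ : ℕ∞) (fun x => ∫ t in a..x, ψ t) :=
    contDiff_infty_iff_deriv.2 ⟨fun x => (hd x).differentiableAt, by rw [hderiv]; exact hψ⟩
  obtain ⟨α, β, hαβ, hK⟩ : ∃ α β, Icc α β ⊆ Ioo a b ∧ tsupport ψ ⊆ Icc α β := by
    rcases (tsupport ψ).eq_empty_or_nonempty with he | hne
    · exact ⟨1, 0, by simp, by simp [he]⟩
    · obtain ⟨x, hx, hx'⟩ := hc.exists_isLeast hne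
      obtain ⟨y, hy, hy'⟩ := hc.exists_isGreatest hne
      exact ⟨x, y, fun z hz => ⟨(hs hx).1.trans_le hz.1, hz.2.trans_lt (hs hy).2⟩,
        fun z hz => ⟨hx' hz, hy' hz⟩⟩
  have hz : ∀ x, x ∉ Icc α β → ψ x = 0 := fun x hx =>
    image_eq_zero_of_notMem_tsupport fun h => hx (hK h)
  have hza : ∀ x ≤ a, ψ x = 0 := fun x hx =>
    image_eq_zero_of_notMem_tsupport fun h => (hs h).1.not_ge hx
  have hzb : ∀ x ≥ b, ψ x = 0 := fun x hx =>
    image_eq_zero_of_notMem_tsupport fun h => (hs h).2.not_ge hx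
  have hsupp : Function.support (fun x => ∫ t in a..x, ψ t) ⊆ Icc α β := by
    intro x hx
    by_contra hxn
    apply hx
    show ∫ t in a..x, ψ t = 0
    rw [mem_Icc, not_and_or, not_le, not_le] at hxn
    rcases hxn with hlt | hgt
    · refine intervalIntegral.integral_zero_ae (Filter.Eventually.of_forall fun t ht => ?_)
      rcases le_total a x with hax | hax
      · rw [uIoc_of_le hax] at ht
        exact hz t fun h => by linarith [ht.2, h.1]
      · rw [uIoc_of_ge hax] at ht
        exact hza t ht.2
    · have h2 : ∫ t in b..x, ψ t = 0 := by
        refine intervalIntegral.integral_zero_ae (Filter.Eventually.of_forall fun t ht => ?_)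
        rcases le_total b x with hax | hax
        · rw [uIoc_of_le hax] at ht
          exact hzb t ht.1.le
        · rw [uIoc_of_ge hax] at ht
          exact hz t fun h => by linarith [ht.1, h.2]
      rw [← intervalIntegral.integral_add_adjacent_intervals (hcont.intervalIntegrable a b)
        (hcont.intervalIntegrable b x), h0, h2, add_zero]
  have hts : tsupport (fun x => ∫ t in a..x, ψ t) ⊆ Icc α β :=
    closure_minimal hsupp isClosed_Icc
  exact ⟨_, hcd, isCompact_Icc.of_isClosed_subset (isClosed_tsupport _) hts, hts.trans hαβ, hderiv⟩

theorem exists_test_integral_one (hab : a < b) :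
    ∃ φ : ℝ → ℝ, ContDiff ℝ (⊤ : ℕ∞) φ ∧ HasCompactSupport φ ∧ tsupport φ ⊆ Ioo a b ∧
      ∫ x in a..b, φ x = 1 := by
  have hm : (a + b) / 2 ∈ Ioo a b := ⟨by linarith, by linarith⟩
  obtain ⟨f, hs, hc, hf, hr, h1⟩ := exists_contDiff_tsupport_subset (n := ⊤)
    (isOpen_Ioo.mem_nhds hm)
  have hpos : 0 < ∫ x in a..b, f x :=
    intervalIntegral.integral_pos hab hf.continuous.continuousOn
      (fun x _ => (hr (mem_range_self x)).1) ⟨_, Ioo_subset_Icc_self hm, by rw [h1]; norm_num⟩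
  refine ⟨fun x => (∫ x in a..b, f x)⁻¹ * f x, contDiff_const.mul hf, hc.mul_left, ?_, ?_⟩
  · exact (closure_mono (Function.support_mul_subset_right _ _)).trans hs
  · rw [intervalIntegral.integral_const_mul, inv_mul_cancel₀ hpos.ne']

/-- A function with integrable weak derivative is almost everywhere equal to a primitive. -/
theorem IsWeakDeriv.exists_isPrim (hab : a < b) {u g : ℝ → ℝ} (h : IsWeakDeriv a b 1 u g)
    (hg : IntervalIntegrable g volume a b) :
    ∃ w, w =ᵐ[volume.restrict (Ioo a b)] u ∧ IsPrim a b w g := by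
  have hG : IsPrim a b (fun x => ∫ t in a..x, g t) g := ⟨hg, fun x _ => by simp⟩
  have hGw := hG.isWeakDeriv hab
  obtain ⟨φ₀, hφ₀, hc₀, hs₀, h1⟩ := exists_test_integral_one hab
  set G := fun x => ∫ t in a..x, g t with hGdef
  have hint : ∀ f : ℝ → ℝ, ∫ x in a..b, f x = ∫ x in Ioo a b, f x := fun f => by
    rw [intervalIntegral.integral_of_le hab.le, integral_Ioc_eq_integral_Ioo]
  set c := ∫ x in Ioo a b, (u x - G x) * φ₀ x with hc
  have hdiff : LocallyIntegrableOn (fun x => u x - G x) (Ioo a b) := h.1.sub hGw.1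
  have hae : (fun x => u x - G x) =ᵐ[volume.restrict (Ioo a b)] fun _ => c := by
    refine ae_eq_of_forall_test hdiff (locallyIntegrableOn_const c) fun ψ hψ hcψ hsψ => ?_
    set I := ∫ x in a..b, ψ x with hI
    have hs1 : tsupport (fun x => ψ x - I * φ₀ x) ⊆ Ioo a b := by
      refine (tsupport_sub ψ (fun x => I * φ₀ x)).trans (union_subset hsψ ?_)
      exact (closure_mono (Function.support_mul_subset_right _ _)).trans hs₀
    have hcs : HasCompactSupport (fun x => ψ x - I * φ₀ x) := hcψ.sub hc₀.mul_left
    have hcI : Continuous (fun x => I * φ₀ x) := continuous_const.mul hφ₀.continuous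
    have hcd : Continuous (fun x => ψ x - I * φ₀ x) := hψ.continuous.sub hcI
    obtain ⟨φ, hφ, hcφ, hsφ, hd⟩ := exists_test_primitive (ψ := fun x => ψ x - I * φ₀ x)
      (hψ.sub (contDiff_const.mul hφ₀)) hcs hs1 (by
        rw [intervalIntegral.integral_sub (hψ.continuous.intervalIntegrable _ _)
          (hcI.intervalIntegrable _ _),
          intervalIntegral.integral_const_mul, h1]
        simp [hI])
    have e1 := h.2.2 φ hφ hcφ hsφ
    have e2 := hGw.2.2 φ hφ hcφ hsφ
    rw [iteratedDeriv_one, hd] at e1 e2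
    have i1 := fun v hv => (integrable_mul_test (a := a) (b := b) (v := v) hv hψ.continuous
      hcψ hsψ).integrableOn (s := Ioo a b)
    have i2 := fun v hv => (integrable_mul_test (a := a) (b := b) (v := v) hv hφ₀.continuous
      hc₀ hs₀).integrableOn (s := Ioo a b)
    have i3 := fun v hv => (integrable_mul_test (a := a) (b := b) (v := v) hv
      hcd hcs hs1).integrableOn (s := Ioo a b)
    have e3 : ∫ x in Ioo a b, (u x - G x) * (ψ x - I * φ₀ x) = 0 := by
      have : ∀ x, (u x - G x) * (ψ x - I * φ₀ x) =
        u x * (ψ x - I * φ₀ x) - G x * (ψ x - I * φ₀ x) := fun x => by ring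
      simp_rw [this]
      rw [integral_sub (i3 _ h.1) (i3 _ hGw.1), e1, e2, sub_self]
    have e4 : ∫ x in Ioo a b, (u x - G x) * (ψ x - I * φ₀ x) =
        (∫ x in Ioo a b, (u x - G x) * ψ x) - I * c := by
      have : ∀ x, (u x - G x) * (ψ x - I * φ₀ x) =
        (u x - G x) * ψ x - I * ((u x - G x) * φ₀ x) := fun x => by ring
      simp_rw [this]
      rw [integral_sub (i1 _ hdiff) ((i2 _ hdiff).const_mul I), integral_const_mul]
    rw [integral_const_mul, ← hint ψ]
    linarith
  refine ⟨fun x => c + G x, ?_, hg, fun x _ => by simp [hGdef]⟩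
  filter_upwards [hae] with x hx
  linarith

theorem MemSobolev.weakDeriv_spec {t : ℝ} {u : ℝ → ℝ} (h : MemSobolev a b t u) {m : ℕ}
    (hm : m ≤ ⌊t⌋₊) :
    IsWeakDeriv a b m u (weakDeriv a b m u) ∧ L2 a b (weakDeriv a b m u) := by
  obtain ⟨g, hg, hgL⟩ := h.1 m hm
  have hex : ∃ g, IsWeakDeriv a b m u g := ⟨g, hg⟩
  have h1 : IsWeakDeriv a b m u (weakDeriv a b m u) := by
    rw [weakDeriv, dif_pos hex]
    exact hex.choose_spec
  exact ⟨h1, hgL.ae_eq (hg.unique h1)⟩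

theorem L2.ofReal_integral_sq {g : ℝ → ℝ} (hab : a ≤ b) (hg : L2 a b g) :
    ENNReal.ofReal (∫ x in a..b, g x ^ 2) = eLpNorm g 2 (volume.restrict (Ioo a b)) ^ 2 := by
  rw [ofReal_intervalIntegral hab (hg.intervalIntegrable_sq hab) fun x => sq_nonneg _]
  have h := eLpNorm_nnreal_pow_eq_lintegral (f := g) (μ := volume.restrict (Ioo a b))
    (p := 2) (by norm_num)
  simp only [NNReal.coe_ofNat, ENNReal.coe_ofNat, ENNReal.rpow_ofNat] at h
  rw [h]
  refine lintegral_congr fun x => ?_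
  rw [Real.enorm_eq_ofReal_abs, ← ENNReal.ofReal_pow (abs_nonneg _), sq_abs]

theorem MemSobolev.sobolevNorm_spec {t : ℝ} {u : ℝ → ℝ} (hab : a ≤ b) (h : MemSobolev a b t u) :
    sobolevNorm a b t u ≠ ∞ ∧
    (∀ m ≤ ⌊t⌋₊, ∫ x in a..b, weakDeriv a b m u x ^ 2 ≤ (sobolevNorm a b t u).toReal ^ 2) ∧
    (Int.fract t ≠ 0 → gagliardoSq a b (Int.fract t) (weakDeriv a b ⌊t⌋₊ u) ≤
      ENNReal.ofReal ((sobolevNorm a b t u).toReal ^ 2)) := by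
  set S := ∑ m ∈ Finset.range (⌊t⌋₊ + 1),
    eLpNorm (weakDeriv a b m u) 2 (volume.restrict (Ioo a b)) ^ 2 + fracPartSq a b t u with hS
  have hN : sobolevNorm a b t u = S ^ (1 / 2 : ℝ) := rfl
  have hfin : S ≠ ∞ := by
    refine ENNReal.add_ne_top.2 ⟨?_, h.2.ne⟩
    refine (ENNReal.sum_lt_top.2 fun m hm => ?_).ne
    exact ENNReal.pow_lt_top (h.weakDeriv_spec (Nat.lt_succ_iff.1 (Finset.mem_range.1 hm))).2.2
  have hsq : (sobolevNorm a b t u).toReal ^ 2 = S.toReal := by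
    rw [hN, ← ENNReal.toReal_rpow, ← Real.rpow_natCast, ← Real.rpow_mul ENNReal.toReal_nonneg]
    norm_num
  have hsq' : ENNReal.ofReal ((sobolevNorm a b t u).toReal ^ 2) = S := by
    rw [hsq, ENNReal.ofReal_toReal hfin]
  refine ⟨by rw [hN]; exact ENNReal.rpow_ne_top_of_nonneg (by norm_num) hfin, fun m hm => ?_,
    fun hθ => ?_⟩
  · rw [← ENNReal.ofReal_le_ofReal_iff (sq_nonneg _), hsq',
      L2.ofReal_integral_sq hab (h.weakDeriv_spec hm).2]
    refine le_trans ?_ le_self_add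
    exact Finset.single_le_sum
      (f := fun m => eLpNorm (weakDeriv a b m u) 2 (volume.restrict (Ioo a b)) ^ 2)
      (fun _ _ => zero_le) (Finset.mem_range.2 (Nat.lt_succ_iff.2 hm))
  · rw [hsq', hS, fracPartSq, if_neg hθ]
    exact le_add_self

theorem IsPrim.abs_le {w g : ℝ → ℝ} {K : ℝ} (hab : a < b) (hK : 0 ≤ K) (h : IsPrim a b w g)
    (hg : L2 a b g) (hwK : ∫ x in a..b, w x ^ 2 ≤ K ^ 2) (hgK : ∫ x in a..b, g x ^ 2 ≤ K ^ 2) :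
    ∀ x ∈ Icc a b, |w x| ≤ (1 + (b - a) + (b - a)⁻¹) * (2 * K) := by
  intro x hx
  have hL : 0 < b - a := sub_pos.2 hab
  have hw : L2 a b w := .of_continuousOn h.continuousOn
  have h1 : |w x| ^ 2 * (b - a) ≤ 2 * K ^ 2 + 2 * (b - a) ^ 2 * K ^ 2 := by
    have hp : ∀ y ∈ Icc a b, w x ^ 2 ≤ 2 * w y ^ 2 + 2 * ((b - a) * K ^ 2) := by
      intro y hy
      have h2 : (w x - w y) ^ 2 ≤ (b - a) * K ^ 2 := by
        have h3 : |w x - w y| ≤ ∫ t in a..b, |g t| := by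
          rw [h.sub_eq hy hx, ← Real.norm_eq_abs]
          refine intervalIntegral.norm_integral_le_integral_norm_uIoc.trans ?_
          simp only [Real.norm_eq_abs]
          rw [intervalIntegral.integral_of_le hab.le]
          refine setIntegral_mono_set ?_ (Filter.Eventually.of_forall fun _ => abs_nonneg _)
            (LE.le.eventuallyLE ?_)
          · rw [← intervalIntegrable_iff_integrableOn_Ioc_of_le hab.le]
            exact h.1.abs
          · exact Ioc_subset_Ioc (le_min hy.1 hx.1) (max_le hy.2 hx.2)
        calc (w x - w y) ^ 2 = |w x - w y| ^ 2 := (sq_abs _).symm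
          _ ≤ (∫ t in a..b, |g t|) ^ 2 := by gcongr
          _ ≤ (b - a) * ∫ t in a..b, g t ^ 2 := hg.sq_integral_abs_le hab.le
          _ ≤ _ := by gcongr
      nlinarith [sq_nonneg (w x - 2 * w y)]
    have hi := intervalIntegral.integral_mono_on hab.le (intervalIntegrable_const)
      (((hw.intervalIntegrable_sq hab.le).const_mul 2).add intervalIntegrable_const) hp
    rw [intervalIntegral.integral_add ((hw.intervalIntegrable_sq hab.le).const_mul 2)
      intervalIntegrable_const, intervalIntegral.integral_const_mul,
      intervalIntegral.integral_const, intervalIntegral.integral_const, smul_eq_mul,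
      smul_eq_mul] at hi
    rw [sq_abs]
    nlinarith
  have h2 : |w x| ^ 2 ≤ 2 * K ^ 2 * ((b - a)⁻¹ + (b - a)) := by
    have : |w x| ^ 2 = |w x| ^ 2 * (b - a) * (b - a)⁻¹ := by field_simp
    rw [this]
    calc _ ≤ (2 * K ^ 2 + 2 * (b - a) ^ 2 * K ^ 2) * (b - a)⁻¹ := by gcongr
      _ = _ := by field_simp
  refine le_of_sq_le_sq (h2.trans ?_) (by positivity)
  have hi : 0 < (b - a)⁻¹ := inv_pos.2 hL
  set p := (b - a)⁻¹ + (b - a) with hp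
  have hp0 : 0 < p := by positivity
  have : 1 + (b - a) + (b - a)⁻¹ = 1 + p := by rw [hp]; ring
  rw [this]
  nlinarith [mul_nonneg (sq_nonneg K) hp0.le, mul_nonneg (sq_nonneg K) (sq_nonneg p), sq_nonneg K]

/-- A function in `H^t` has a representative that is an iterated primitive of a function in
`H^θ`, where `θ` is the fractional part of `t`. -/
theorem MemSobolev.exists_sobBound (hab : a < b) (t : ℝ) :
    ∃ C : ℝ, 0 < C ∧ ∀ u, MemSobolev a b t u → ∃ w, w =ᵐ[volume.restrict (Ioo a b)] u ∧
      SobBound a b (Int.fract t) ⌊t⌋₊ (C * (sobolevNorm a b t u).toReal) w := by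
  have hL : 0 < b - a := sub_pos.2 hab
  refine ⟨(1 + (b - a) + (b - a)⁻¹) * 2, by positivity, fun u hu => ?_⟩
  set N := (sobolevNorm a b t u).toReal with hN
  have hN0 : 0 ≤ N := ENNReal.toReal_nonneg
  set C := (1 + (b - a) + (b - a)⁻¹) * 2 with hC
  have hi : 0 < (b - a)⁻¹ := inv_pos.2 hL
  have hC1 : 1 ≤ C := by rw [hC]; linarith
  obtain ⟨-, hb, hgag⟩ := hu.sobolevNorm_spec hab.le
  have hNC : N ≤ C * N := by nlinarith
  have hcong : ∀ w v : ℝ → ℝ, w =ᵐ[volume.restrict (Ioo a b)] v →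
      ∫ x in a..b, w x ^ 2 = ∫ x in a..b, v x ^ 2 := by
    intro w v h
    rw [intervalIntegral.integral_of_le hab.le, intervalIntegral.integral_of_le hab.le,
      integral_Ioc_eq_integral_Ioo, integral_Ioc_eq_integral_Ioo]
    exact integral_congr_ae (h.mono fun x hx => by simp only [hx])
  have main : ∀ j ≤ ⌊t⌋₊, ∃ w, w =ᵐ[volume.restrict (Ioo a b)] weakDeriv a b (⌊t⌋₊ - j) u ∧
      SobBound a b (Int.fract t) j (C * N) w := by
    intro j
    induction j with
    | zero =>
      intro _
      refine ⟨_, Filter.EventuallyEq.rfl, FracBound.mono_const ?_ hN0 hNC⟩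
      exact ⟨(hu.weakDeriv_spec (by simp)).2, hb _ (by simp), hgag⟩
    | succ j ih =>
      intro hj
      obtain ⟨w, hw, hwb⟩ := ih (by omega)
      obtain ⟨hd1, hl1⟩ := hu.weakDeriv_spec (m := ⌊t⌋₊ - (j + 1)) (by omega)
      obtain ⟨hd2, hl2⟩ := hu.weakDeriv_spec (m := ⌊t⌋₊ - j) (by omega)
      rw [show ⌊t⌋₊ - j = ⌊t⌋₊ - (j + 1) + 1 by omega] at hd2
      have hd := hd1.succ hd2
      rw [show ⌊t⌋₊ - (j + 1) + 1 = ⌊t⌋₊ - j by omega] at hd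
      obtain ⟨v, hv, hvp⟩ := hd.exists_isPrim hab (hl2.intervalIntegrable hab.le)
      have hvp' := hvp.congr_deriv hab.le hw.symm
      refine ⟨v, hv, fun x hx => ?_, w, hwb, hvp'⟩
      rw [hC, mul_assoc]
      refine hvp'.abs_le hab hN0 hwb.l2 ?_ ?_ x hx
      · rw [hcong _ _ hv]; exact hb _ (by omega)
      · rw [hcong _ _ hw]; exact hb _ (by omega)
  obtain ⟨w, hw, hwb⟩ := main ⌊t⌋₊ le_rfl
  refine ⟨w, hw.trans ?_, hwb⟩
  rw [Nat.sub_self]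
  obtain ⟨hd, -⟩ := hu.weakDeriv_spec (m := 0) (by simp)
  refine ae_eq_of_forall_test hd.2.1 hd.1 fun φ hφ hc hs => ?_
  simpa using (hd.2.2 φ hφ hc hs).symm

end

/-! ### Meshes -/

theorem sum_succ_sub_castSucc {n : ℕ} (G : Fin (n + 1) → ℝ) :
    ∑ i : Fin n, (G i.succ - G i.castSucc) = G (Fin.last n) - G 0 := by
  rw [Finset.sum_sub_distrib]
  have h1 := Fin.sum_univ_succ G
  have h2 := Fin.sum_univ_castSucc G
  linarith

namespace Mesh

variable {a b : ℝ} (M : Mesh a b)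

theorem left_lt_right (i : Fin M.n) : M.left i < M.right i :=
  M.strictMono Fin.castSucc_lt_succ

theorem pt_mem (i : Fin (M.n + 1)) : M.pt i ∈ Icc a b := by
  have h1 := M.strictMono.monotone (Fin.zero_le i)
  have h2 := M.strictMono.monotone (Fin.le_last i)
  rw [M.pt_zero] at h1
  rw [M.pt_last] at h2
  exact ⟨h1, h2⟩

theorem left_mem (i : Fin M.n) : M.left i ∈ Icc a b := M.pt_mem _

theorem right_mem (i : Fin M.n) : M.right i ∈ Icc a b := M.pt_mem _

theorem len_pos (i : Fin M.n) : 0 < M.len i := sub_pos.2 (M.left_lt_right i)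

theorem len_le_size (i : Fin M.n) : M.len i ≤ M.size :=
  le_ciSup (Finite.bddAbove_range M.len) i

theorem size_nonneg : 0 ≤ M.size := Real.iSup_nonneg fun i => (M.len_pos i).le

theorem sum_integral {f : ℝ → ℝ} (hf : IntervalIntegrable f volume a b) :
    ∑ i, ∫ x in M.left i..M.right i, f x = ∫ x in a..b, f x := by
  have hab : a ≤ b := (M.pt_mem 0).1.trans (M.pt_mem 0).2
  have hF : IsPrim a b (fun x => ∫ t in a..x, f t) f := ⟨hf, fun x _ => by simp⟩
  have h := sum_succ_sub_castSucc (fun j => ∫ t in a..M.pt j, f t)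
  rw [M.pt_last, M.pt_zero, intervalIntegral.integral_same, sub_zero] at h
  rw [← h]
  exact Finset.sum_congr rfl fun i _ => (hF.sub_eq (M.left_mem i) (M.right_mem i)).symm

theorem right_le_left {i j : Fin M.n} (hij : i < j) : M.right i ≤ M.left j :=
  M.strictMono.monotone (Fin.le_def.2 (by
    have := Fin.lt_def.1 hij
    simp only [Fin.val_succ, Fin.val_castSucc]
    omega))

theorem disjoint_Ioo {i j : Fin M.n} (hij : i ≠ j) :
    Disjoint (Ioo (M.left i) (M.right i)) (Ioo (M.left j) (M.right j)) := by
  rw [Set.disjoint_left]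
  intro x hx hy
  rcases lt_or_gt_of_ne hij with h | h
  · have := M.right_le_left h
    linarith [hx.2, hy.1]
  · have := M.right_le_left h
    linarith [hx.1, hy.2]

theorem exists_mem_Ioo {x : ℝ} (hx : x ∈ Ioo a b) (hxp : ∀ j, x ≠ M.pt j) :
    ∃ i, x ∈ Ioo (M.left i) (M.right i) := by
  by_contra! hn
  have h : ∀ j : Fin (M.n + 1), M.pt j < x := by
    intro j
    induction j using Fin.induction with
    | zero => rw [M.pt_zero]; exact hx.1
    | succ i ih => exact lt_of_le_of_ne (not_lt.1 fun h => hn i ⟨ih, h⟩) (hxp _).symm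
  have := h (Fin.last _)
  rw [M.pt_last] at this
  exact this.not_gt hx.2

theorem ae_exists_mem_Ioo :
    ∀ᵐ x ∂volume.restrict (Ioo a b), ∃ i, x ∈ Ioo (M.left i) (M.right i) := by
  have h0 : ∀ᵐ x : ℝ, x ∉ range M.pt :=
    (measure_eq_zero_iff_ae_notMem).1 ((finite_range M.pt).measure_zero volume)
  filter_upwards [ae_restrict_mem measurableSet_Ioo, ae_restrict_of_ae h0] with x hx hx0
  exact M.exists_mem_Ioo hx fun j hj => hx0 ⟨j, hj.symm⟩

theorem sum_gagliardoSq_le (θ : ℝ) (g : ℝ → ℝ) :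
    ∑ i, gagliardoSq (M.left i) (M.right i) θ g ≤ gagliardoSq a b θ g := by
  have hsub : ∀ i, Ioo (M.left i) (M.right i) ⊆ Ioo a b := fun i =>
    Ioo_subset_Ioo (M.left_mem i).1 (M.right_mem i).2
  set F : ℝ → ℝ≥0∞ := fun x => ∫⁻ y in Ioo a b,
    ENNReal.ofReal (|g x - g y| ^ 2 / |x - y| ^ (1 + 2 * θ)) with hF
  calc ∑ i, gagliardoSq (M.left i) (M.right i) θ g
      ≤ ∑ i, ∫⁻ x in Ioo (M.left i) (M.right i), F x :=
        Finset.sum_le_sum fun i _ => lintegral_mono fun x => lintegral_mono_set (hsub i)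
    _ = ∫⁻ x in ⋃ i, Ioo (M.left i) (M.right i), F x := by
        rw [lintegral_iUnion (fun _ => measurableSet_Ioo) (fun i j hij => M.disjoint_Ioo hij),
          tsum_fintype]
    _ ≤ _ := lintegral_mono_set (iUnion_subset hsub)

end Mesh

namespace FESpace

variable {a b : ℝ} {M : Mesh a b} {k : ℕ} (v : FESpace M k)

theorem fn_eq {i : Fin M.n} {x : ℝ} (hx : x ∈ Ioo (M.left i) (M.right i)) :
    v.fn x = (v.interior i).eval x := by
  rw [fn, Finset.sum_eq_single i]
  · rw [indicator_of_mem hx]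
  · intro j _ hji
    exact indicator_of_notMem (fun h => (M.disjoint_Ioo hji).le_bot ⟨h, hx⟩) _
  · simp

theorem l2_fn : L2 a b v.fn := by
  have : v.fn = fun x => ∑ i, (Ioo (M.left i) (M.right i)).indicator
      (fun y => (v.interior i).eval y) x := rfl
  rw [this]
  refine memLp_finsetSum _ fun i _ => ?_
  exact (L2.polynomial (v.interior i) a b).indicator measurableSet_Ioo

theorem integral_mul_fn {X : ℝ → ℝ} (hab : a ≤ b) (hX : L2 a b X) :
    ∫ x in a..b, X x * v.fn x =
      ∑ i, ∫ x in M.left i..M.right i, X x * (v.interior i).eval x := by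
  rw [← M.sum_integral (hX.intervalIntegrable_mul v.l2_fn hab)]
  refine Finset.sum_congr rfl fun i _ => ?_
  simp only [intervalIntegral.integral_of_le (M.left_lt_right i).le, integral_Ioc_eq_integral_Ioo]
  exact setIntegral_congr_fun measurableSet_Ioo fun x hx => by simp only [v.fn_eq hx]

end FESpace

/-! ### Polynomial approximation -/

theorem exists_derivative_eq (p : ℝ[X]) (c y : ℝ) :
    ∃ P : ℝ[X], P.derivative = p ∧ P.natDegree ≤ p.natDegree + 1 ∧ P.eval c = y := by
  obtain ⟨Q, hQ, hQd⟩ : ∃ Q : ℝ[X], Q.derivative = p ∧ Q.natDegree ≤ p.natDegree + 1 := by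
    refine ⟨∑ i ∈ Finset.range (p.natDegree + 1), monomial (i + 1) (p.coeff i / (i + 1)), ?_, ?_⟩
    · conv_rhs => rw [p.as_sum_range]
      rw [derivative_sum]
      refine Finset.sum_congr rfl fun i _ => ?_
      rw [derivative_monomial]
      have : (i : ℝ) + 1 ≠ 0 := by positivity
      congr 1
      push_cast
      field_simp
    · refine natDegree_sum_le_of_forall_le _ _ fun i hi => ?_
      refine (natDegree_monomial_le _).trans ?_
      have := Finset.mem_range.1 hi
      omega
  refine ⟨Q + C (y - Q.eval c), by simp [hQ], ?_, by simp⟩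
  rw [natDegree_add_C]
  exact hQd

theorem IsPrim.sq_le {l r : ℝ} {w g : ℝ → ℝ} (h : IsPrim l r w g) (hw : w l = 0) (hg : L2 l r g) :
    ∀ x ∈ Icc l r, w x ^ 2 ≤ (r - l) * ∫ t in l..r, g t ^ 2 := by
  intro x hx
  have hlr : l ≤ r := hx.1.trans hx.2
  have h0 : ∀ c d : ℝ, c ≤ d → 0 ≤ ∫ t in c..d, g t ^ 2 := fun c d hcd =>
    intervalIntegral.integral_nonneg hcd fun t _ => sq_nonneg _
  rw [h.2 x hx, hw, zero_add]
  calc (∫ t in l..x, g t) ^ 2 ≤ (x - l) * ∫ t in l..x, g t ^ 2 :=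
        (hg.mono le_rfl hx.2).sq_integral_le hx.1
    _ ≤ (r - l) * ∫ t in l..r, g t ^ 2 := by
        refine mul_le_mul (by linarith [hx.2]) ?_ (h0 _ _ hx.1) (by linarith)
        exact intervalIntegral.integral_mono_interval le_rfl hx.1 hx.2
          (Filter.Eventually.of_forall fun _ => sq_nonneg _) (hg.intervalIntegrable_sq hlr)

theorem IsPrim.sub {l r : ℝ} {w v g g' : ℝ → ℝ} (hw : IsPrim l r w g) (hv : IsPrim l r v g') :
    IsPrim l r (fun x => w x - v x) (fun x => g x - g' x) := by
  refine ⟨hw.1.sub hv.1, fun x hx => ?_⟩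
  have ha : l ∈ Icc l r := left_mem_Icc.2 (hx.1.trans hx.2)
  beta_reduce
  rw [hw.2 x hx, hv.2 x hx, intervalIntegral.integral_sub (hw.integrable_sub ha hx)
    (hv.integrable_sub ha hx)]
  ring

/-- Poincaré's inequality for functions that vanish at the left endpoint. -/
theorem IsPrim.integral_sq_le {l r : ℝ} {w g : ℝ → ℝ} (hlr : l ≤ r) (h : IsPrim l r w g)
    (hw : w l = 0) (hg : L2 l r g) :
    ∫ x in l..r, w x ^ 2 ≤ (r - l) ^ 2 * ∫ t in l..r, g t ^ 2 := by
  have hL : L2 l r w := .of_continuousOn h.continuousOn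
  refine (intervalIntegral.integral_mono_on hlr (hL.intervalIntegrable_sq hlr)
    intervalIntegrable_const (h.sq_le hw hg)).trans_eq ?_
  rw [intervalIntegral.integral_const, smul_eq_mul]
  ring

theorem SobBound.exists_approx_l2 {a b θ : ℝ} (hab : a < b) (hθ : 0 ≤ θ) (M : Mesh a b) {n : ℕ}
    {K : ℝ} {w : ℝ → ℝ} (h : SobBound a b θ n K w) :
    ∃ p : Fin M.n → ℝ[X], (∀ i, (p i).natDegree ≤ n) ∧
      ∑ i, ∫ x in M.left i..M.right i, (w x - (p i).eval x) ^ 2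
        ≤ (K * (M.size ^ n * M.size ^ θ)) ^ 2 := by
  have hs := M.size_nonneg
  induction n generalizing w with
  | zero =>
    obtain ⟨hL, hK, hgag⟩ := h
    rcases hθ.eq_or_lt with rfl | hθ
    · refine ⟨0, by simp, ?_⟩
      simp only [Pi.zero_apply, eval_zero, sub_zero, pow_zero, Real.rpow_zero, mul_one]
      rw [M.sum_integral (hL.intervalIntegrable_sq hab.le)]
      exact hK
    · refine ⟨fun i => C (mean (M.left i) (M.right i) w), by simp, ?_⟩
      simp only [eval_C]
      have hi0 : ∀ i, 0 ≤ ∫ x in M.left i..M.right i, (w x - mean (M.left i) (M.right i) w) ^ 2 :=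
        fun i => intervalIntegral.integral_nonneg (M.left_lt_right i).le fun _ _ => sq_nonneg _
      rw [← ENNReal.ofReal_le_ofReal_iff (sq_nonneg _), ENNReal.ofReal_sum_of_nonneg
        fun i _ => hi0 i]
      calc _ ≤ ∑ i, ENNReal.ofReal (M.size ^ (2 * θ)) * gagliardoSq (M.left i) (M.right i) θ w := by
            refine Finset.sum_le_sum fun i _ => ?_
            refine (fractional_poincare (M.left_lt_right i) hθ.le
              (hL.mono (M.left_mem i).1 (M.right_mem i).2)).trans ?_
            gcongr
            · exact (M.len_pos i).le
            · exact M.len_le_size i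
        _ ≤ ENNReal.ofReal (M.size ^ (2 * θ)) * ENNReal.ofReal (K ^ 2) := by
            rw [← Finset.mul_sum]
            exact mul_le_mul_right ((M.sum_gagliardoSq_le θ w).trans (hgag hθ.ne')) _
        _ = _ := by
            rw [← ENNReal.ofReal_mul (by positivity), pow_zero, one_mul, mul_pow, mul_comm,
              mul_comm 2 θ, Real.rpow_mul hs, Real.rpow_two]
  | succ n ih =>
    obtain ⟨-, g, hg, hp⟩ := h
    obtain ⟨p, hpd, hpb⟩ := ih hg
    choose P hP1 hP2 hP3 using fun i => exists_derivative_eq (p i) (M.left i) (w (M.left i))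
    refine ⟨P, fun i => (hP2 i).trans (Nat.succ_le_succ (hpd i)), ?_⟩
    calc _ ≤ ∑ i, M.size ^ 2 * ∫ x in M.left i..M.right i, (g x - (p i).eval x) ^ 2 := by
          refine Finset.sum_le_sum fun i _ => ?_
          have hPi := IsPrim.polynomial (P i) (M.left i) (M.right i)
          rw [hP1] at hPi
          have hlr := (M.left_lt_right i).le
          have h1 := ((hp.mono (M.left_mem i) (M.right_mem i)).sub hPi).integral_sq_le hlr
            (by simp [hP3]) ((hg.l2.mono (M.left_mem i).1 (M.right_mem i).2).sub
              (L2.polynomial (p i) _ _))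
          refine h1.trans ?_
          have h2 : 0 ≤ ∫ x in M.left i..M.right i, (g x - (p i).eval x) ^ 2 :=
            intervalIntegral.integral_nonneg hlr fun _ _ => sq_nonneg _
          have h3 := M.len_le_size i
          have h4 := (M.len_pos i).le
          rw [Mesh.len] at h3 h4
          gcongr
      _ ≤ M.size ^ 2 * (K * (M.size ^ n * M.size ^ θ)) ^ 2 := by
          rw [← Finset.mul_sum]
          gcongr
      _ = _ := by ring

theorem IsPrim.abs_sub_le {c d ε : ℝ} {w g : ℝ → ℝ} (h : IsPrim c d w g)
    (hg : ∀ x ∈ Icc c d, |g x| ≤ ε) : ∀ x ∈ Icc c d, |w x - w c| ≤ ε * (d - c) := by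
  intro x hx
  have hc := left_mem_Icc.2 (hx.1.trans hx.2)
  rw [h.sub_eq hc hx]
  have h2 := intervalIntegral.norm_integral_le_of_norm_le_const (a := c) (b := x) (C := ε)
    (f := g) (by
      intro t ht
      rw [uIoc_of_le hx.1] at ht
      exact hg t ⟨ht.1.le, ht.2.trans hx.2⟩)
  rw [Real.norm_eq_abs, abs_of_nonneg (sub_nonneg.2 hx.1)] at h2
  exact h2.trans (mul_le_mul_of_nonneg_left (by linarith [hx.2]) ((abs_nonneg _).trans (hg c hc)))

theorem exists_approx_of_deriv {c d ε : ℝ} {w g : ℝ → ℝ} (h : IsPrim c d w g)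
    {p : ℝ[X]} (hp : ∀ x ∈ Icc c d, |g x - p.eval x| ≤ ε) :
    ∃ P : ℝ[X], P.natDegree ≤ p.natDegree + 1 ∧
      ∀ x ∈ Icc c d, |w x - P.eval x| ≤ ε * (d - c) := by
  obtain ⟨P, hP1, hP2, hP3⟩ := exists_derivative_eq p c (w c)
  have hPp := IsPrim.polynomial P c d
  rw [hP1] at hPp
  refine ⟨P, hP2, fun x hx => ?_⟩
  have h1 := (h.sub hPp).abs_sub_le hp x hx
  simpa only [hP3, sub_self, sub_zero] using h1

/-- Approximation in the maximum norm by polynomials of degree at most `k`, where `m + θ ≤ k`. -/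
theorem SobBound.exists_approx_sup {a b θ : ℝ} (hab : a < b) (hθ : 0 ≤ θ) (hθ1 : θ < 1) (m k : ℕ)
    (hk : (m : ℝ) + θ ≤ k) :
    ∃ D : ℝ, 0 < D ∧ ∀ (K : ℝ) (w : ℝ → ℝ), 0 ≤ K → SobBound a b θ (m + 2) K w →
      ∀ c d, a ≤ c → c < d → d ≤ b → ∃ p : ℝ[X], p.natDegree ≤ k ∧
        ∀ x ∈ Icc c d, |w x - p.eval x| ≤ D * K * ((d - c) * ((d - c) ^ m * (d - c) ^ θ)) := by
  rcases hθ.eq_or_lt with rfl | hθ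
  · refine ⟨1, one_pos, fun K w hK h c d hac hcd hdb => ?_⟩
    have hmk : m ≤ k := by rw [add_zero] at hk; exact_mod_cast hk
    suffices H : ∃ p : ℝ[X], p.natDegree ≤ m ∧
        ∀ x ∈ Icc c d, |w x - p.eval x| ≤ K * (d - c) * (d - c) ^ m by
      obtain ⟨p, hp, H⟩ := H
      exact ⟨p, hp.trans hmk, fun x hx => (H x hx).trans_eq (by simp; ring)⟩
    clear hk hmk
    have hc : c ∈ Icc a b := ⟨hac, hcd.le.trans hdb⟩
    have hd : d ∈ Icc a b := ⟨hac.trans hcd.le, hdb⟩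
    induction m generalizing w with
    | zero =>
      obtain ⟨-, g, hg, hp⟩ := h
      refine ⟨C (w c), by simp, fun x hx => ?_⟩
      rw [eval_C, pow_zero, mul_one]
      exact (hp.mono hc hd).abs_sub_le
        (fun y hy => hg.1 y ⟨hac.trans hy.1, hy.2.trans hdb⟩) x hx
    | succ m ih =>
      obtain ⟨-, g, hg, hp⟩ := h
      obtain ⟨q, hq, hq'⟩ := ih g hg
      obtain ⟨P, hP, hP'⟩ := exists_approx_of_deriv (hp.mono hc hd) hq'
      exact ⟨P, hP.trans (Nat.succ_le_succ hq), fun x hx => (hP' x hx).trans_eq (by ring)⟩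
  · obtain ⟨D, hD, H⟩ := SobBound.exists_holder hab hθ.le hθ1
    refine ⟨D * (b - a) ^ ((1 - θ) / 2), by have := sub_pos.2 hab; positivity,
      fun K w hK h c d hac hcd hdb => ?_⟩
    have hmk : m + 1 ≤ k := by
      have : (m : ℝ) < k := by linarith
      exact_mod_cast this
    have hl : 0 < d - c := sub_pos.2 hcd
    suffices H : ∃ p : ℝ[X], p.natDegree ≤ m + 1 ∧
        ∀ x ∈ Icc c d, |w x - p.eval x| ≤ D * K * (d - c) ^ ((1 + θ) / 2) * (d - c) ^ (m + 1) by
      obtain ⟨p, hp, H⟩ := H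
      refine ⟨p, hp.trans hmk, fun x hx => (H x hx).trans ?_⟩
      have e : (d - c) ^ ((1 + θ) / 2) = (d - c) ^ ((1 - θ) / 2) * (d - c) ^ θ := by
        rw [← Real.rpow_add hl]; congr 1; ring
      have e2 : (d - c) ^ ((1 - θ) / 2) ≤ (b - a) ^ ((1 - θ) / 2) :=
        Real.rpow_le_rpow hl.le (by linarith) (by linarith)
      rw [e]
      calc D * K * ((d - c) ^ ((1 - θ) / 2) * (d - c) ^ θ) * (d - c) ^ (m + 1)
          ≤ D * K * ((b - a) ^ ((1 - θ) / 2) * (d - c) ^ θ) * (d - c) ^ (m + 1) := by gcongr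
        _ = _ := by ring
    clear hk hmk
    have hc : c ∈ Icc a b := ⟨hac, hcd.le.trans hdb⟩
    have hd : d ∈ Icc a b := ⟨hac.trans hcd.le, hdb⟩
    have base : ∀ v, SobBound a b θ 1 K v →
        ∀ x ∈ Icc c d, |v x - (C (v c)).eval x| ≤ D * K * (d - c) ^ ((1 + θ) / 2) := by
      intro v hv x hx
      rw [eval_C]
      refine (H K v hK hv x ⟨hac.trans hx.1, hx.2.trans hdb⟩ c hc).trans ?_
      rw [abs_of_nonneg (sub_nonneg.2 hx.1)]
      gcongr
      · linarith [hx.1]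
      · exact hx.2
    induction m generalizing w with
    | zero =>
      obtain ⟨-, g, hg, hp⟩ := h
      obtain ⟨P, hP, hP'⟩ := exists_approx_of_deriv (hp.mono hc hd) (base g hg)
      exact ⟨P, by simpa using hP, fun x hx => (hP' x hx).trans_eq (by ring)⟩
    | succ m ih =>
      obtain ⟨-, g, hg, hp⟩ := h
      obtain ⟨q, hq, hq'⟩ := ih g hg
      obtain ⟨P, hP, hP'⟩ := exists_approx_of_deriv (hp.mono hc hd) hq'
      exact ⟨P, hP.trans (Nat.succ_le_succ hq), fun x hx => (hP' x hx).trans_eq (by ring)⟩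

/-! ### Stability of the discrete weak derivative -/

theorem exists_eval_endpoint_sq_le (k : ℕ) :
    ∃ D : ℝ, 0 < D ∧ ∀ (l r : ℝ), l ≠ r → ∀ p : ℝ[X], p.natDegree ≤ k →
      p.eval l ^ 2 ≤ D * ((r - l)⁻¹ * ∫ x in l..r, p.eval x ^ 2) := by
  obtain ⟨d, hd, -⟩ := existsUnique_isDiscreteWeakDeriv (xa := 0) (xb := 1) one_pos k
    (v0 := fun _ => 0) intervalIntegrable_const (-1) 0
  have hD : 0 ≤ ∫ x in (0 : ℝ)..1, d.eval x ^ 2 :=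
    intervalIntegral.integral_nonneg zero_le_one fun _ _ => sq_nonneg _
  refine ⟨1 + ∫ x in (0 : ℝ)..1, d.eval x ^ 2, by positivity, fun l r hlr p hp => ?_⟩
  set q : ℝ[X] := p.comp (C l + C (r - l) * X) with hq
  have hqd : q.natDegree ≤ k := by
    refine natDegree_comp_le.trans ?_
    have h1 : (C l + C (r - l) * X : ℝ[X]).natDegree ≤ 1 :=
      (natDegree_add_le _ _).trans (max_le (by simp) (natDegree_C_mul_le _ _ |>.trans natDegree_X_le))
    nlinarith
  have hqe : ∀ t, q.eval t = p.eval (l + (r - l) * t) := fun t => by simp [hq]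
  have h1 := hd.2 q hqd
  simp only [zero_mul, intervalIntegral.integral_zero, neg_zero, zero_add, neg_mul, one_mul,
    sub_neg_eq_add] at h1
  have h2 := (L2.polynomial d 0 1).cauchySchwarz (L2.polynomial q 0 1) zero_le_one
  rw [h1, hqe 0, mul_zero, add_zero] at h2
  have h3 : ∫ t in (0 : ℝ)..1, q.eval t ^ 2 = (r - l)⁻¹ * ∫ x in l..r, p.eval x ^ 2 := by
    simp_rw [hqe]
    rw [intervalIntegral.integral_comp_add_mul (fun y => p.eval y ^ 2) (sub_ne_zero.2 hlr.symm) l,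
      smul_eq_mul]
    simp
  have h4 : 0 ≤ ∫ t in (0 : ℝ)..1, q.eval t ^ 2 :=
    intervalIntegral.integral_nonneg zero_le_one fun _ _ => sq_nonneg _
  rw [h3] at h2 h4
  nlinarith

/-- The inverse inequality between the maximum norm and the `L²` norm of polynomials. -/
theorem exists_eval_sq_le (k : ℕ) :
    ∃ D : ℝ, 0 < D ∧ ∀ (l r : ℝ), l < r → ∀ p : ℝ[X], p.natDegree ≤ k → ∀ x ∈ Icc l r,
      p.eval x ^ 2 * (r - l) ≤ D * ∫ x in l..r, p.eval x ^ 2 := by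
  obtain ⟨D, hD, H⟩ := exists_eval_endpoint_sq_le k
  refine ⟨2 * D, by positivity, fun l r hlr p hp x hx => ?_⟩
  have hi := (L2.polynomial p l r).intervalIntegrable_sq hlr.le
  have hmono : ∀ c d, l ≤ c → c ≤ d → d ≤ r →
      ∫ x in c..d, p.eval x ^ 2 ≤ ∫ x in l..r, p.eval x ^ 2 := fun c d hc hcd hd =>
    intervalIntegral.integral_mono_interval hc hcd hd
      (Filter.Eventually.of_forall fun _ => sq_nonneg _) hi
  rcases le_total x ((l + r) / 2) with hm | hm
  · have hxr : 0 < r - x := by linarith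
    have h := H x r (by linarith) p hp
    rw [inv_mul_eq_div, mul_div_assoc', le_div_iff₀ hxr] at h
    have h2 := hmono x r hx.1 hx.2 le_rfl
    nlinarith [sq_nonneg (p.eval x)]
  · have hxl : 0 < x - l := by linarith
    have h := H x l (by linarith) p hp
    rw [intervalIntegral.integral_symm, ← neg_sub x l, inv_neg, neg_mul_neg, inv_mul_eq_div,
      mul_div_assoc', le_div_iff₀ hxl] at h
    have h2 := hmono l x le_rfl hx.1 hx.2
    nlinarith [sq_nonneg (p.eval x)]

namespace FESpace

variable {a b : ℝ} {M : Mesh a b} {k : ℕ} (v : FESpace M k)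

theorem dw_spec (r : ℕ) (i : Fin M.n) :
    IsDiscreteWeakDeriv (M.left i) (M.right i) r (fun x => (v.interior i).eval x)
      (v.val i.castSucc) (v.val i.succ) (v.dw r i) :=
  discreteWeakDeriv_spec (M.left_lt_right i) r
    ((v.interior i).continuous.intervalIntegrable _ _) _ _

theorem integral_dw (r : ℕ) (i : Fin M.n) :
    ∫ x in M.left i..M.right i, (v.dw r i).eval x = v.val i.succ - v.val i.castSucc := by
  have h := (v.dw_spec r i).2 1 (by simp)
  simpa using h

/-- The square of the norm of the discrete weak derivative. -/
def energy (r : ℕ) : ℝ := ∑ i, ∫ x in M.left i..M.right i, (v.dw r i).eval x ^ 2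

theorem integral_dw_sq_nonneg (r : ℕ) (i : Fin M.n) :
    0 ≤ ∫ x in M.left i..M.right i, (v.dw r i).eval x ^ 2 :=
  intervalIntegral.integral_nonneg (M.left_lt_right i).le fun _ _ => sq_nonneg _

theorem integral_dw_sq_le_energy (r : ℕ) (i : Fin M.n) :
    ∫ x in M.left i..M.right i, (v.dw r i).eval x ^ 2 ≤ v.energy r :=
  Finset.single_le_sum (f := fun i => ∫ x in M.left i..M.right i, (v.dw r i).eval x ^ 2)
    (fun i _ => v.integral_dw_sq_nonneg r i) (Finset.mem_univ i)

theorem energy_nonneg (r : ℕ) : 0 ≤ v.energy r :=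
  Finset.sum_nonneg fun i _ => v.integral_dw_sq_nonneg r i

theorem val_sq_le (hab : a ≤ b) (r : ℕ) (j : Fin (M.n + 1)) :
    v.val j ^ 2 ≤ (b - a) * v.energy r := by
  let d : FESpace M r := ⟨fun i => v.dw r i, 0, fun i => (v.dw_spec r i).1, rfl⟩
  have hprim : IsPrim a b (fun x => ∫ t in a..x, d.fn t) d.fn :=
    ⟨d.l2_fn.intervalIntegrable hab, fun x _ => by simp⟩
  have hcong : ∀ (g : ℝ → ℝ → ℝ) (i : Fin M.n), ∫ x in M.left i..M.right i, g x (d.fn x) =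
      ∫ x in M.left i..M.right i, g x ((v.dw r i).eval x) := by
    intro g i
    simp only [intervalIntegral.integral_of_le (M.left_lt_right i).le, integral_Ioc_eq_integral_Ioo]
    exact setIntegral_congr_fun measurableSet_Ioo fun x hx => by simp only [d.fn_eq hx]; rfl
  have hval : ∀ j, v.val j = ∫ t in a..M.pt j, d.fn t := by
    intro j
    induction j using Fin.induction with
    | zero => rw [M.pt_zero, v.val_zero, intervalIntegral.integral_same]
    | succ i ih =>
      have h1 := hprim.sub_eq (M.left_mem i) (M.right_mem i)
      have h2 := hcong (fun _ y => y) i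
      rw [v.integral_dw] at h2
      rw [h2] at h1
      have h3 : ∫ t in a..M.right i, d.fn t = ∫ t in a..M.pt i.succ, d.fn t := rfl
      have h4 : ∫ t in a..M.left i, d.fn t = ∫ t in a..M.pt i.castSucc, d.fn t := rfl
      linarith
  have hE : ∫ t in a..b, d.fn t ^ 2 = v.energy r := by
    rw [← M.sum_integral (d.l2_fn.intervalIntegrable_sq hab), energy]
    exact Finset.sum_congr rfl fun i _ => hcong (fun _ y => y ^ 2) i
  have hj := M.pt_mem j
  have hmain := hprim.sq_le (by simp) d.l2_fn (M.pt j) hj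
  rw [hE] at hmain
  rw [hval]
  exact hmain

/-- The discrete Poincaré inequality in the maximum norm. -/
theorem exists_eval_sq_le_energy {a b : ℝ} (hab : a < b) (k : ℕ) :
    ∃ D : ℝ, 0 < D ∧ ∀ (M : Mesh a b) (v : FESpace M k) (i : Fin M.n),
      ∀ x ∈ Icc (M.left i) (M.right i), (v.interior i).eval x ^ 2 ≤ D * v.energy (k + 1) := by
  obtain ⟨D, hD, H⟩ := WeakFE.exists_eval_sq_le k
  have hL : 0 < b - a := sub_pos.2 hab
  refine ⟨4 * D * (b - a), by positivity, fun M v i x hx => ?_⟩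
  set l := M.left i with hl
  set r := M.right i with hr
  set e := v.interior i with he
  have hlr : l < r := M.left_lt_right i
  have hlr' : 0 < r - l := sub_pos.2 hlr
  have hle : r - l ≤ b - a := by linarith [(M.left_mem i).1, (M.right_mem i).2]
  set S := v.energy (k + 1) with hS
  have hS0 : 0 ≤ S := v.energy_nonneg _
  obtain ⟨q, hq1, hq2, hq3⟩ := exists_derivative_eq e l 0
  have hqp := IsPrim.polynomial q l r
  rw [hq1] at hqp
  have heL := L2.polynomial e l r
  set E := ∫ x in l..r, e.eval x ^ 2 with hE
  have hE0 : 0 ≤ E := intervalIntegral.integral_nonneg hlr.le fun _ _ => sq_nonneg _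
  have h1 := (v.dw_spec (k + 1) i).2 q (hq2.trans (Nat.succ_le_succ (v.natDegree_le i)))
  rw [hq1, hq3, mul_zero, sub_zero] at h1
  have h2 : E = v.val i.succ * q.eval r - ∫ x in l..r, (v.dw (k + 1) i).eval x * q.eval x := by
    have : E = ∫ x in l..r, e.eval x * e.eval x := by simp only [hE, sq]
    linarith
  have h3 : q.eval r ^ 2 ≤ (r - l) * E := hqp.sq_le hq3 heL r (right_mem_Icc.2 hlr.le)
  have h4 : ∫ x in l..r, q.eval x ^ 2 ≤ (r - l) ^ 2 * E := hqp.integral_sq_le hlr.le hq3 heL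
  have h5 : (∫ x in l..r, (v.dw (k + 1) i).eval x * q.eval x) ^ 2 ≤ S * ((r - l) ^ 2 * E) :=
    ((L2.polynomial (v.dw (k + 1) i) l r).cauchySchwarz (L2.polynomial q l r) hlr.le).trans
      (mul_le_mul (v.integral_dw_sq_le_energy _ i) h4
        (intervalIntegral.integral_nonneg hlr.le fun _ _ => sq_nonneg _) hS0)
  have h6 := v.val_sq_le hab.le (k + 1) i.succ
  have h7 : (v.val i.succ * q.eval r) ^ 2 ≤ ((b - a) * S) * ((r - l) * E) := by
    rw [mul_pow]
    exact mul_le_mul h6 h3 (sq_nonneg _) (by positivity)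
  have h8 : E ^ 2 ≤ 4 * (b - a) * (r - l) * S * E := by
    set y := v.val i.succ * q.eval r
    set z := ∫ x in l..r, (v.dw (k + 1) i).eval x * q.eval x
    have h9 : S * ((r - l) ^ 2 * E) ≤ (b - a) * S * ((r - l) * E) := by
      have : 0 ≤ S * ((r - l) * E) * ((b - a) - (r - l)) :=
        mul_nonneg (by positivity) (by linarith)
      nlinarith
    have h10 : E ^ 2 = (y - z) ^ 2 := congrArg (· ^ 2) h2
    rw [h10]
    nlinarith [sq_nonneg (y + z)]
  have h10 : E ≤ 4 * (b - a) * (r - l) * S := by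
    rcases hE0.eq_or_lt with h0 | h0
    · rw [← h0]; positivity
    · rw [sq] at h8
      exact le_of_mul_le_mul_right h8 h0
  have h11 := H l r hlr e (v.natDegree_le i) x hx
  refine le_of_mul_le_mul_right (h11.trans ?_) hlr'
  calc D * E ≤ D * (4 * (b - a) * (r - l) * S) := by gcongr
    _ = _ := by ring

end FESpace

/-! ### The error equation -/

theorem L2.mul_continuousOn {c d : ℝ} {g v : ℝ → ℝ} (hg : L2 c d g)
    (hv : ContinuousOn v (Icc c d)) : L2 c d (fun x => v x * g x) := by
  obtain ⟨K, hK⟩ := isCompact_Icc.exists_bound_of_continuousOn hv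
  refine hg.of_le_mul (c := K) (((hv.mono Ioo_subset_Icc_self).aestronglyMeasurable
    measurableSet_Ioo).mul hg.1) ?_
  filter_upwards [ae_restrict_mem measurableSet_Ioo] with x hx
  rw [norm_mul]
  exact mul_le_mul_of_nonneg_right (hK x (Ioo_subset_Icc_self hx)) (norm_nonneg _)

theorem intervalIntegral_congr_ae_Ioo {a b c d : ℝ} (hac : a ≤ c) (hcd : c ≤ d) (hdb : d ≤ b)
    {f g : ℝ → ℝ} (h : f =ᵐ[volume.restrict (Ioo a b)] g) :
    ∫ x in c..d, f x = ∫ x in c..d, g x := by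
  simp only [intervalIntegral.integral_of_le hcd, integral_Ioc_eq_integral_Ioo]
  exact integral_congr_ae
    (ae_restrict_of_ae_restrict_of_subset (Ioo_subset_Ioo hac hdb) h)

theorem energy_identity {a b : ℝ} (hab : a < b) {M : Mesh a b} {k : ℕ} {A Z f U G Q R : ℝ → ℝ}
    (hA : ContinuousOn A (Icc a b)) (hZ : ContinuousOn Z (Icc a b))
    (hU : IsPrim a b U G) (hUa : U a = 0) (hR : L2 a b R) (hQ : IsPrim a b Q R) (hQb : Q b = 0)
    (hf : f =ᵐ[volume.restrict (Ioo a b)] fun x => Z x * U x - R x)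
    {uh : FESpace M k} (huh : IsWeakFESolution (k + 1) A Z f uh)
    {p d ρ π : Fin M.n → ℝ[X]}
    (hp : ∀ i, (p i).natDegree ≤ k) (hpp : ∀ i, ∀ q : ℝ[X], q.natDegree ≤ k →
      ∫ x in M.left i..M.right i, (p i).eval x * q.eval x =
        ∫ x in M.left i..M.right i, U x * q.eval x)
    (hd : ∀ i, (d i).natDegree ≤ k + 1) (hdd : ∀ i, ∀ q : ℝ[X], q.natDegree ≤ k + 1 →
      ∫ x in M.left i..M.right i, (d i).eval x * q.eval x =
        ∫ x in M.left i..M.right i, G x * q.eval x)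
    (hρρ : ∀ i, ∀ q : ℝ[X], q.natDegree ≤ k →
      ∫ x in M.left i..M.right i, (ρ i).eval x * q.eval x =
        ∫ x in M.left i..M.right i, R x * q.eval x)
    (hπ : ∀ i, (π i).derivative = ρ i) (hπd : ∀ i, (π i).natDegree ≤ k + 1)
    (hπl : ∀ i, (π i).eval (M.left i) = Q (M.left i)) :
    ∃ e : FESpace M k, (∀ i, e.interior i = p i - uh.interior i) ∧
      (∑ i, ∫ x in M.left i..M.right i, A x * (e.dw (k + 1) i).eval x ^ 2) +
        (∑ i, ∫ x in M.left i..M.right i, Z x * (e.interior i).eval x ^ 2) =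
      (∑ i, ∫ x in M.left i..M.right i,
          (A x * (d i).eval x - (π i).eval x) * (e.dw (k + 1) i).eval x) +
        ∑ i, ∫ x in M.left i..M.right i,
          Z x * ((p i).eval x - U x) * (e.interior i).eval x := by
  let e : FESpace M k :=
    { interior := fun i => p i - uh.interior i
      val := fun j => U (M.pt j) - uh.val j
      natDegree_le := fun i => (natDegree_sub_le _ _).trans (max_le (hp i) (uh.natDegree_le i))
      val_zero := by rw [M.pt_zero, hUa, uh.val_zero, sub_zero] }
  refine ⟨e, fun i => rfl, ?_⟩
  have hlr := fun i => (M.left_lt_right i).le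
  have hL : ∀ (i : Fin M.n) {g : ℝ → ℝ}, L2 a b g → L2 (M.left i) (M.right i) g := fun i g hg =>
    hg.mono (M.left_mem i).1 (M.right_mem i).2
  have hP : ∀ (i : Fin M.n) (q : ℝ[X]), L2 (M.left i) (M.right i) (fun x => q.eval x) :=
    fun i q => .polynomial q _ _
  have hUc := hU.continuousOn
  have hUL : L2 a b U := .of_continuousOn hUc
  have hcont : ∀ (i : Fin M.n) {g : ℝ → ℝ}, ContinuousOn g (Icc a b) →
      ContinuousOn g (Icc (M.left i) (M.right i)) := fun i g hg =>
    hg.mono (Icc_subset_Icc (M.left_mem i).1 (M.right_mem i).2)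
  have hedw : ∀ i, e.dw (k + 1) i = d i - uh.dw (k + 1) i := by
    intro i
    have hint : IntervalIntegrable (fun x => (e.interior i).eval x) volume (M.left i) (M.right i) :=
      (e.interior i).continuous.intervalIntegrable _ _
    refine (existsUnique_isDiscreteWeakDeriv (M.left_lt_right i) (k + 1) hint
      (e.val i.castSucc) (e.val i.succ)).unique (e.dw_spec (k + 1) i) ⟨?_, fun q hq => ?_⟩
    · exact (natDegree_sub_le _ _).trans (max_le (hd i) (uh.dw_spec (k + 1) i).1)
    have h1 := (uh.dw_spec (k + 1) i).2 q hq
    have h2 := hdd i q hq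
    have h3 := (hU.mono (M.left_mem i) (M.right_mem i)).parts (hlr i) (.polynomial q _ _)
    have hq' : q.derivative.natDegree ≤ k := (natDegree_derivative_le q).trans (by omega)
    have h4 := hpp i q.derivative hq'
    simp only [eval_sub, sub_mul]
    rw [intervalIntegral.integral_sub ((hP i _).intervalIntegrable_mul (hP i q) (hlr i))
      ((hP i _).intervalIntegrable_mul (hP i q) (hlr i)), h1, h2, h3]
    show _ = -(∫ x in M.left i..M.right i, (p i - uh.interior i).eval x * q.derivative.eval x)
      + (U (M.right i) - uh.val i.succ) * q.eval (M.right i)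
      - (U (M.left i) - uh.val i.castSucc) * q.eval (M.left i)
    simp only [eval_sub, sub_mul]
    rw [intervalIntegral.integral_sub ((hP i _).intervalIntegrable_mul (hP i _) (hlr i))
      ((hP i _).intervalIntegrable_mul (hP i _) (hlr i)), h4]
    ring
  have hmain := huh e
  have hZuh : ∫ x in a..b, Z x * uh.fn x * e.fn x =
      ∑ i, ∫ x in M.left i..M.right i, Z x * (uh.interior i).eval x * (e.interior i).eval x := by
    rw [e.integral_mul_fn hab.le (uh.l2_fn.mul_continuousOn hZ)]
    refine Finset.sum_congr rfl fun i _ => ?_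
    simp only [intervalIntegral.integral_of_le (hlr i), integral_Ioc_eq_integral_Ioo]
    exact setIntegral_congr_fun measurableSet_Ioo fun x hx => by simp only [uh.fn_eq hx]
  have hfe : ∫ x in a..b, f x * e.fn x = ∑ i, ∫ x in M.left i..M.right i,
      (Z x * U x - R x) * (e.interior i).eval x := by
    have hX : L2 a b (fun x => Z x * U x - R x) := (hUL.mul_continuousOn hZ).sub hR
    rw [← e.integral_mul_fn hab.le hX]
    refine intervalIntegral_congr_ae_Ioo le_rfl hab.le le_rfl ?_
    filter_upwards [hf] with x hx
    rw [hx]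
  have hRe : ∀ i, ∫ x in M.left i..M.right i, R x * (e.interior i).eval x =
      -(∫ x in M.left i..M.right i, (π i).eval x * (e.dw (k + 1) i).eval x) +
        (e.val i.succ * Q (M.pt i.succ) - e.val i.castSucc * Q (M.pt i.castSucc)) := by
    intro i
    have h1 := (e.dw_spec (k + 1) i).2 (π i) (hπd i)
    have h2 := hρρ i _ (e.natDegree_le i)
    have h3 : (π i).eval (M.right i) = Q (M.right i) := by
      have h4 := hρρ i 1 (by simp)
      simp only [eval_one, mul_one] at h4
      rw [← hQ.sub_eq (M.left_mem i) (M.right_mem i)] at h4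
      have h5 := (IsPrim.polynomial (π i) (M.left i) (M.right i)).sub_eq
        (left_mem_Icc.2 (hlr i)) (right_mem_Icc.2 (hlr i))
      rw [hπ, h4, hπl] at h5
      linarith
    rw [hπ, h3, hπl] at h1
    rw [← h2]
    simp only [mul_comm (eval _ (π i)), mul_comm (eval _ (ρ i))]
    rw [h1]
    show _ = -(-_ + e.val i.succ * Q (M.pt i.succ) - e.val i.castSucc * Q (M.pt i.castSucc)) + _
    ring
  have htel : ∑ i : Fin M.n, (e.val i.castSucc * Q (M.pt i.castSucc) -
      e.val i.succ * Q (M.pt i.succ)) = 0 := by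
    rw [← neg_eq_zero, ← Finset.sum_neg_distrib]
    simp only [neg_sub]
    rw [sum_succ_sub_castSucc (fun j => e.val j * Q (M.pt j)), M.pt_last, hQb, e.val_zero]
    ring
  rw [hZuh, hfe, ← Finset.sum_add_distrib] at hmain
  rw [← Finset.sum_add_distrib, ← Finset.sum_add_distrib]
  rw [← sub_eq_zero] at hmain ⊢
  rw [← Finset.sum_sub_distrib] at hmain ⊢
  rw [← neg_eq_zero, ← Finset.sum_neg_distrib, ← htel, ← sub_eq_zero, ← Finset.sum_sub_distrib]
    at hmain
  rw [← hmain]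
  refine Finset.sum_congr rfl fun i _ => ?_
  have hAL : ∀ q : ℝ[X], L2 (M.left i) (M.right i) (fun x => A x * q.eval x) := fun q =>
    (hP i q).mul_continuousOn (hcont i hA)
  have hZL : ∀ q : ℝ[X], L2 (M.left i) (M.right i) (fun x => Z x * q.eval x) := fun q =>
    (hP i q).mul_continuousOn (hcont i hZ)
  have hZU : L2 (M.left i) (M.right i) (fun x => Z x * U x) :=
    (hL i hUL).mul_continuousOn (hcont i hZ)
  have hi := hlr i
  have huδ : uh.dw (k + 1) i = d i - e.dw (k + 1) i := by rw [hedw i]; ring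
  have hRei := hRe i
  set δ := e.dw (k + 1) i with hδ
  have huε : uh.interior i = p i - e.interior i := (sub_sub_cancel _ _).symm
  set ε := e.interior i with hε
  have e1 : ∫ x in M.left i..M.right i, A x * (uh.dw (k + 1) i).eval x * δ.eval x =
      (∫ x in M.left i..M.right i, A x * (d i).eval x * δ.eval x) -
        ∫ x in M.left i..M.right i, A x * δ.eval x ^ 2 := by
    rw [huδ]
    simp only [eval_sub, mul_sub, sub_mul, sq, ← mul_assoc]
    exact intervalIntegral.integral_sub ((hAL _).intervalIntegrable_mul (hP i _) hi)
      ((hAL _).intervalIntegrable_mul (hP i _) hi)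
  have e2 : ∫ x in M.left i..M.right i, Z x * (uh.interior i).eval x * ε.eval x =
      (∫ x in M.left i..M.right i, Z x * (p i).eval x * ε.eval x) -
        ∫ x in M.left i..M.right i, Z x * ε.eval x ^ 2 := by
    rw [huε]
    simp only [eval_sub, mul_sub, sub_mul, sq, ← mul_assoc]
    exact intervalIntegral.integral_sub ((hZL _).intervalIntegrable_mul (hP i _) hi)
      ((hZL _).intervalIntegrable_mul (hP i _) hi)
  have e3 : ∫ x in M.left i..M.right i, (Z x * U x - R x) * ε.eval x =
      (∫ x in M.left i..M.right i, Z x * U x * ε.eval x) -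
        ∫ x in M.left i..M.right i, R x * ε.eval x := by
    simp only [sub_mul]
    exact intervalIntegral.integral_sub (hZU.intervalIntegrable_mul (hP i _) hi)
      ((hL i hR).intervalIntegrable_mul (hP i _) hi)
  have e4 : ∫ x in M.left i..M.right i, (A x * (d i).eval x - (π i).eval x) * δ.eval x =
      (∫ x in M.left i..M.right i, A x * (d i).eval x * δ.eval x) -
        ∫ x in M.left i..M.right i, (π i).eval x * δ.eval x := by
    simp only [sub_mul]
    exact intervalIntegral.integral_sub ((hAL _).intervalIntegrable_mul (hP i _) hi)
      ((hP i _).intervalIntegrable_mul (hP i _) hi)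
  have e5 : ∫ x in M.left i..M.right i, Z x * ((p i).eval x - U x) * ε.eval x =
      (∫ x in M.left i..M.right i, Z x * (p i).eval x * ε.eval x) -
        ∫ x in M.left i..M.right i, Z x * U x * ε.eval x := by
    simp only [mul_sub, sub_mul]
    exact intervalIntegral.integral_sub ((hZL _).intervalIntegrable_mul (hP i _) hi)
      (hZU.intervalIntegrable_mul (hP i _) hi)
  rw [e1, e2, e3, e4, e5, hRei]
  ring

theorem Mesh.sum_len {a b : ℝ} (M : Mesh a b) : ∑ i, M.len i = b - a := by
  have h := sum_succ_sub_castSucc M.pt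
  rw [M.pt_last, M.pt_zero] at h
  exact h

/-- The `L²` projection of a function is a good approximation in the maximum norm. -/
theorem exists_projection_sup_le (k : ℕ) :
    ∃ D : ℝ, 0 < D ∧ ∀ (l r ε : ℝ) (w : ℝ → ℝ) (p q : ℝ[X]), l < r → ContinuousOn w (Icc l r) →
      p.natDegree ≤ k → q.natDegree ≤ k → (∀ q : ℝ[X], q.natDegree ≤ k →
        ∫ x in l..r, p.eval x * q.eval x = ∫ x in l..r, w x * q.eval x) →
      (∀ x ∈ Icc l r, |w x - q.eval x| ≤ ε) → ∀ x ∈ Icc l r, |w x - p.eval x| ≤ D * ε := by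
  obtain ⟨D, hD, H⟩ := exists_eval_sq_le k
  refine ⟨1 + √D, by positivity, fun l r ε w p q hlr hw hp hq hproj hε x hx => ?_⟩
  have hε0 : 0 ≤ ε := (abs_nonneg _).trans (hε x hx)
  have hl : 0 < r - l := sub_pos.2 hlr
  have hwL : L2 l r w := .of_continuousOn hw
  have h1 := (projection_sq_le hlr hwL hp hproj hq).2
  have hwq : L2 l r (fun x => w x - q.eval x) := hwL.sub (L2.polynomial q l r)
  have h2 : ∫ x in l..r, (w x - q.eval x) ^ 2 ≤ ∫ _ in l..r, ε ^ 2 :=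
    intervalIntegral.integral_mono_on hlr.le (hwq.intervalIntegrable_sq hlr.le)
      intervalIntegrable_const fun y hy => sq_le_sq.2 ((hε y hy).trans (le_abs_self ε))
  rw [intervalIntegral.integral_const, smul_eq_mul] at h2
  have h3 := H l r hlr (p - q) ((natDegree_sub_le _ _).trans (max_le hp hq)) x hx
  have h4 : (p - q).eval x ^ 2 ≤ D * ε ^ 2 := by
    refine le_of_mul_le_mul_right (h3.trans ?_) hl
    calc _ ≤ D * ((r - l) * ε ^ 2) := by gcongr; exact h1.trans h2
      _ = _ := by ring
  have h5 : |(p - q).eval x| ≤ √D * ε := by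
    refine abs_le_of_sq_le_sq ?_ (by positivity)
    rw [mul_pow, Real.sq_sqrt hD.le]
    exact h4
  calc |w x - p.eval x| = |(w x - q.eval x) - (p - q).eval x| := by
        rw [eval_sub]; congr 1; ring
    _ ≤ |w x - q.eval x| + |(p - q).eval x| := abs_sub _ _
    _ ≤ ε + √D * ε := add_le_add (hε x hx) h5
    _ = _ := by ring

/-- The energy estimate of the error. -/
theorem sqrt_energy_le {a b : ℝ} (hab : a < b) {M : Mesh a b} {k : ℕ} {A Z U : ℝ → ℝ}
    {amin Z₁ ε D ρ : ℝ} (hA : ContinuousOn A (Icc a b)) (hZ : ContinuousOn Z (Icc a b))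
    (hAmin : ∀ x ∈ Icc a b, amin ≤ A x) (hZ0 : ∀ x ∈ Icc a b, 0 ≤ Z x)
    (hZ1 : ∀ x ∈ Icc a b, |Z x| ≤ Z₁) (hD : 0 ≤ D) (hρ : 0 ≤ ρ) (hε : 0 ≤ ε)
    {p d π : Fin M.n → ℝ[X]} {e : FESpace M k}
    (hid : (∑ i, ∫ x in M.left i..M.right i, A x * (e.dw (k + 1) i).eval x ^ 2) +
        (∑ i, ∫ x in M.left i..M.right i, Z x * (e.interior i).eval x ^ 2) =
      (∑ i, ∫ x in M.left i..M.right i,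
          (A x * (d i).eval x - (π i).eval x) * (e.dw (k + 1) i).eval x) +
        ∑ i, ∫ x in M.left i..M.right i,
          Z x * ((p i).eval x - U x) * (e.interior i).eval x)
    (hdπ : ∑ i, ∫ x in M.left i..M.right i, (A x * (d i).eval x - (π i).eval x) ^ 2 ≤ ρ ^ 2)
    (hp : ∀ i, ∀ x ∈ Icc (M.left i) (M.right i), |U x - (p i).eval x| ≤ ε)
    (he : ∀ i, ∀ x ∈ Icc (M.left i) (M.right i),
      (e.interior i).eval x ^ 2 ≤ D * e.energy (k + 1)) :
    amin * √(e.energy (k + 1)) ≤ ρ + Z₁ * ε * √D * (b - a) := by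
  have hL : 0 < b - a := sub_pos.2 hab
  have hZ₁ : 0 ≤ Z₁ := (abs_nonneg _).trans (hZ1 a (left_mem_Icc.2 hab.le))
  set S := e.energy (k + 1) with hS
  have hS0 : 0 ≤ S := e.energy_nonneg _
  have hlr := fun i => (M.left_lt_right i).le
  have hsub : ∀ i, Icc (M.left i) (M.right i) ⊆ Icc a b := fun i =>
    Icc_subset_Icc (M.left_mem i).1 (M.right_mem i).2
  have hAc := fun i => hA.mono (hsub i)
  have hZc := fun i => hZ.mono (hsub i)
  have hP : ∀ (i : Fin M.n) (q : ℝ[X]), ContinuousOn (fun x => q.eval x)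
      (Icc (M.left i) (M.right i)) := fun i q => q.continuous.continuousOn
  have hII : ∀ (i : Fin M.n) {g : ℝ → ℝ}, ContinuousOn g (Icc (M.left i) (M.right i)) →
      IntervalIntegrable g volume (M.left i) (M.right i) := fun i g hg =>
    (L2.of_continuousOn hg).intervalIntegrable (hlr i)
  have h1 : amin * S ≤ ∑ i, ∫ x in M.left i..M.right i, A x * (e.dw (k + 1) i).eval x ^ 2 := by
    rw [hS, FESpace.energy, Finset.mul_sum]
    refine Finset.sum_le_sum fun i _ => ?_
    rw [← intervalIntegral.integral_const_mul]
    refine intervalIntegral.integral_mono_on (hlr i)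
      (hII i (((hP i (e.dw (k + 1) i)).pow 2).const_mul amin))
      (hII i ((hAc i).mul ((hP i (e.dw (k + 1) i)).pow 2))) fun x hx => ?_
    exact mul_le_mul_of_nonneg_right (hAmin x (hsub i hx)) (sq_nonneg _)
  have h2 : 0 ≤ ∑ i, ∫ x in M.left i..M.right i, Z x * (e.interior i).eval x ^ 2 :=
    Finset.sum_nonneg fun i _ => intervalIntegral.integral_nonneg (hlr i) fun x hx =>
      mul_nonneg (hZ0 x (hsub i hx)) (sq_nonneg _)
  have h3 : ∑ i, ∫ x in M.left i..M.right i,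
      (A x * (d i).eval x - (π i).eval x) * (e.dw (k + 1) i).eval x ≤ ρ * √S := by
    refine le_of_sq_le_sq ?_ (by positivity)
    have h4 := Finset.sum_sq_le_sum_mul_sum_of_sq_le_mul (Finset.univ : Finset (Fin M.n))
      (r := fun i => ∫ x in M.left i..M.right i,
        (A x * (d i).eval x - (π i).eval x) * (e.dw (k + 1) i).eval x)
      (f := fun i => ∫ x in M.left i..M.right i, (A x * (d i).eval x - (π i).eval x) ^ 2)
      (g := fun i => ∫ x in M.left i..M.right i, (e.dw (k + 1) i).eval x ^ 2)
      (fun i _ => intervalIntegral.integral_nonneg (hlr i) fun _ _ => sq_nonneg _)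
      (fun i _ => e.integral_dw_sq_nonneg (k + 1) i)
      (fun i _ => L2.cauchySchwarz
        (.of_continuousOn (((hAc i).mul (hP i (d i))).sub (hP i (π i))))
        (.polynomial (e.dw (k + 1) i) _ _) (hlr i))
    refine h4.trans ?_
    rw [mul_pow, Real.sq_sqrt hS0]
    exact mul_le_mul_of_nonneg_right hdπ hS0
  have h5 : ∑ i, ∫ x in M.left i..M.right i,
      Z x * ((p i).eval x - U x) * (e.interior i).eval x ≤ Z₁ * ε * √D * (b - a) * √S := by
    calc _ ≤ ∑ i, (Z₁ * ε * (√D * √S)) * M.len i := by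
          refine Finset.sum_le_sum fun i _ => ?_
          have h6 := intervalIntegral.norm_integral_le_of_norm_le_const (a := M.left i)
            (b := M.right i) (C := Z₁ * ε * (√D * √S))
            (f := fun x => Z x * ((p i).eval x - U x) * (e.interior i).eval x) (by
              intro x hx
              rw [uIoc_of_le (hlr i)] at hx
              have hx' := Ioc_subset_Icc_self hx
              rw [norm_mul, norm_mul, Real.norm_eq_abs, Real.norm_eq_abs, Real.norm_eq_abs,
                abs_sub_comm]
              have h7 : |(e.interior i).eval x| ≤ √D * √S := by
                refine abs_le_of_sq_le_sq ?_ (by positivity)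
                rw [mul_pow, Real.sq_sqrt hD, Real.sq_sqrt hS0]
                exact he i x hx'
              gcongr
              · exact hZ1 x (hsub i hx')
              · exact hp i x hx')
          rw [Real.norm_eq_abs, abs_of_pos (sub_pos.2 (M.left_lt_right i))] at h6
          exact (le_abs_self _).trans h6
      _ = _ := by
          rw [← Finset.mul_sum, M.sum_len]
          ring
  have h8 : amin * √S * √S ≤ (ρ + Z₁ * ε * √D * (b - a)) * √S := by
    rw [mul_assoc, Real.mul_self_sqrt hS0]
    linarith
  rcases (Real.sqrt_nonneg S).eq_or_lt with h0 | h0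
  · rw [← h0, mul_zero]
    positivity
  · exact le_of_mul_le_mul_right h8 h0

/-- The error estimate in terms of representatives of the coefficients and of the solution. -/
theorem exists_sup_error_le {a b : ℝ} (hab : a < b) (k m : ℕ) {θ amin KA KZ : ℝ} (hθ : 0 ≤ θ)
    (hθ1 : θ < 1) (hmk : (m : ℝ) + θ ≤ k) (hamin : 0 < amin) (hKA : 0 ≤ KA) {A Z : ℝ → ℝ}
    (hA : SobBound a b θ (m + 1) KA A) (hAmin : ∀ x ∈ Icc a b, amin ≤ A x)
    (hZ : ContinuousOn Z (Icc a b)) (hZ0 : ∀ x ∈ Icc a b, 0 ≤ Z x)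
    (hZ1 : ∀ x ∈ Icc a b, |Z x| ≤ KZ) :
    ∃ C : ℝ, 0 < C ∧ ∀ (M : Mesh a b) (f U G : ℝ → ℝ) (K : ℝ) (uh : FESpace M k), 0 ≤ K →
      SobBound a b θ (m + 2) K U → SobBound a b θ (m + 1) K G → IsPrim a b U G →
      U a = 0 → G b = 0 →
      (∀ R, IsPrim a b (fun x => A x * G x) R →
        f =ᵐ[volume.restrict (Ioo a b)] (fun x => Z x * U x - R x)) →
      IsWeakFESolution (k + 1) A Z f uh →
      ∀ᵐ x ∂volume.restrict (Ioo a b), |U x - uh.fn x| ≤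
        C * K * (M.size * (M.size ^ m * M.size ^ θ)) := by
  have hL : 0 < b - a := sub_pos.2 hab
  obtain ⟨Cm, hCm, Hmul⟩ := SobBound.exists_mul hab hθ hθ1 m
  obtain ⟨Da, hDa, Hsup⟩ := SobBound.exists_approx_sup hab hθ hθ1 m k hmk
  obtain ⟨Dp, hDp, Hproj⟩ := exists_projection_sup_le k
  obtain ⟨De, hDe, Hpoinc⟩ := FESpace.exists_eval_sq_le_energy hab k
  have hKZ : 0 ≤ KZ := (abs_nonneg _).trans (hZ1 a (left_mem_Icc.2 hab.le))
  have hmk' : m ≤ k := by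
    have : (m : ℝ) ≤ k := by linarith
    exact_mod_cast this
  refine ⟨Dp * Da + √De * ((2 * KA * (1 + Cm) + KZ * (Dp * Da) * √De * (b - a)) / amin),
    by positivity, ?_⟩
  intro M f U G K uh hK hUb hGb hUG hUa hGb0 hf huh
  obtain ⟨-, R, hRb, hQR⟩ := Hmul KA K A G hKA hK hA hGb
  set Q := fun x => A x * G x with hQ
  have hUL : L2 a b U := hUb.l2
  have hlt := M.left_lt_right
  have hL2 : ∀ (i : Fin M.n) {g : ℝ → ℝ}, L2 a b g → L2 (M.left i) (M.right i) g := fun i g hg =>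
    hg.mono (M.left_mem i).1 (M.right_mem i).2
  have hsub : ∀ i, Icc (M.left i) (M.right i) ⊆ Icc a b := fun i =>
    Icc_subset_Icc (M.left_mem i).1 (M.right_mem i).2
  have hsize := M.size_nonneg
  set η := M.size * (M.size ^ m * M.size ^ θ) with hη
  have hη0 : 0 ≤ η := by positivity
  choose p hp hpp using fun i => exists_projection (hlt i) k
    ((hL2 i hUL).intervalIntegrable (hlt i).le)
  choose d hd hdd using fun i => exists_projection (hlt i) (k + 1)
    ((hL2 i hGb.l2).intervalIntegrable (hlt i).le)
  choose ρ hρ hρρ using fun i => exists_projection (hlt i) k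
    ((hL2 i hRb.l2).intervalIntegrable (hlt i).le)
  choose π hπ hπd hπl using fun i => exists_derivative_eq (ρ i) (M.left i) (Q (M.left i))
  obtain ⟨e, heI, hid⟩ := energy_identity hab hA.continuousOn hZ hUG hUa hRb.l2 hQR
    (by simp only [hQ, hGb0, mul_zero]) (hf R hQR) huh hp hpp hd hdd hρρ hπ
    (fun i => (hπd i).trans (Nat.succ_le_succ (hρ i))) hπl
  have hε : ∀ i, ∀ x ∈ Icc (M.left i) (M.right i),
      |U x - (p i).eval x| ≤ Dp * Da * K * η := by
    intro i
    obtain ⟨q, hq, hq'⟩ := Hsup K U hK hUb _ _ (M.left_mem i).1 (hlt i) (M.right_mem i).2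
    have h := Hproj _ _ _ U (p i) q (hlt i) (hUG.continuousOn.mono (hsub i)) (hp i) hq (hpp i) hq'
    intro x hx
    refine (h x hx).trans ?_
    have h1 := M.len_le_size i
    have h2 := (M.len_pos i).le
    rw [Mesh.len] at h1 h2
    rw [show Dp * Da * K * η = Dp * (Da * K * η) by ring, hη]
    gcongr
  have hG2 : ∑ i, ∫ x in M.left i..M.right i, (G x - (d i).eval x) ^ 2 ≤ (K * η) ^ 2 := by
    obtain ⟨q, hq, hq'⟩ := hGb.exists_approx_l2 hab hθ M
    calc _ ≤ ∑ i, ∫ x in M.left i..M.right i, (G x - (q i).eval x) ^ 2 :=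
          Finset.sum_le_sum fun i _ => (projection_sq_le (hlt i) (hL2 i hGb.l2) (hd i) (hdd i)
            ((hq i).trans (by omega))).1
      _ ≤ _ := hq'
      _ = _ := by rw [hη]; ring
  have hR2 : ∑ i, ∫ x in M.left i..M.right i, (R x - (ρ i).eval x) ^ 2
      ≤ (Cm * (KA * K) * (M.size ^ m * M.size ^ θ)) ^ 2 := by
    obtain ⟨q, hq, hq'⟩ := hRb.exists_approx_l2 hab hθ M
    exact (Finset.sum_le_sum fun i _ => (projection_sq_le (hlt i) (hL2 i hRb.l2) (hρ i) (hρρ i)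
      ((hq i).trans hmk')).1).trans hq'
  have hQπ : ∀ i, IsPrim (M.left i) (M.right i) (fun x => Q x - (π i).eval x)
      (fun x => R x - (ρ i).eval x) := fun i => by
    have h := IsPrim.polynomial (π i) (M.left i) (M.right i)
    rw [hπ] at h
    exact (hQR.mono (M.left_mem i) (M.right_mem i)).sub h
  have hQ2 : ∑ i, ∫ x in M.left i..M.right i, (Q x - (π i).eval x) ^ 2
      ≤ (Cm * (KA * K) * η) ^ 2 := by
    calc _ ≤ ∑ i, M.size ^ 2 * ∫ x in M.left i..M.right i, (R x - (ρ i).eval x) ^ 2 := by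
          refine Finset.sum_le_sum fun i _ => ?_
          refine ((hQπ i).integral_sq_le (hlt i).le (by simp [hπl])
            ((hL2 i hRb.l2).sub (L2.polynomial (ρ i) _ _))).trans ?_
          have h2 : 0 ≤ ∫ x in M.left i..M.right i, (R x - (ρ i).eval x) ^ 2 :=
            intervalIntegral.integral_nonneg (hlt i).le fun _ _ => sq_nonneg _
          have h3 := M.len_le_size i
          have h4 := (M.len_pos i).le
          rw [Mesh.len] at h3 h4
          gcongr
      _ ≤ M.size ^ 2 * (Cm * (KA * K) * (M.size ^ m * M.size ^ θ)) ^ 2 := by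
          rw [← Finset.mul_sum]
          gcongr
      _ = _ := by rw [hη]; ring
  have hdπ : ∑ i, ∫ x in M.left i..M.right i, (A x * (d i).eval x - (π i).eval x) ^ 2
      ≤ (2 * KA * (1 + Cm) * K * η) ^ 2 := by
    calc _ ≤ ∑ i, (2 * KA ^ 2 * (∫ x in M.left i..M.right i, (G x - (d i).eval x) ^ 2) +
            2 * ∫ x in M.left i..M.right i, (Q x - (π i).eval x) ^ 2) := by
          refine Finset.sum_le_sum fun i _ => ?_
          have hAi := hA.continuousOn.mono (hsub i)
          have h1 : L2 (M.left i) (M.right i) (fun x => A x * (d i).eval x - (π i).eval x) :=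
            .of_continuousOn ((hAi.mul (d i).continuous.continuousOn).sub
              (π i).continuous.continuousOn)
          have h2 : L2 (M.left i) (M.right i) (fun x => G x - (d i).eval x) :=
            (hL2 i hGb.l2).sub (L2.polynomial (d i) _ _)
          have h3 : L2 (M.left i) (M.right i) (fun x => Q x - (π i).eval x) :=
            .of_continuousOn (hQπ i).continuousOn
          have h2' := (h2.intervalIntegrable_sq (hlt i).le).const_mul (2 * KA ^ 2)
          have h3' := (h3.intervalIntegrable_sq (hlt i).le).const_mul 2
          rw [← intervalIntegral.integral_const_mul, ← intervalIntegral.integral_const_mul,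
            ← intervalIntegral.integral_add h2' h3']
          refine intervalIntegral.integral_mono_on (hlt i).le
            (h1.intervalIntegrable_sq (hlt i).le) (h2'.add h3') fun x hx => ?_
          have hAx : A x ^ 2 ≤ KA ^ 2 := sq_le_sq.2 ((hA.1 x (hsub i hx)).trans (le_abs_self KA))
          set g := G x - (d i).eval x with hg
          set q := Q x - (π i).eval x with hq
          have e1 : A x * (d i).eval x - (π i).eval x = q - A x * g := by
            rw [hq, hg, hQ]; ring
          rw [e1]
          nlinarith [sq_nonneg (q + A x * g), mul_le_mul_of_nonneg_right hAx (sq_nonneg g)]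
      _ = 2 * KA ^ 2 * (∑ i, ∫ x in M.left i..M.right i, (G x - (d i).eval x) ^ 2) +
            2 * ∑ i, ∫ x in M.left i..M.right i, (Q x - (π i).eval x) ^ 2 := by
          rw [Finset.sum_add_distrib, Finset.mul_sum, Finset.mul_sum]
      _ ≤ 2 * KA ^ 2 * (K * η) ^ 2 + 2 * (Cm * (KA * K) * η) ^ 2 := by gcongr
      _ = (KA * K * η) ^ 2 * (2 + 2 * Cm ^ 2) := by ring
      _ ≤ (KA * K * η) ^ 2 * (4 * (1 + Cm) ^ 2) := by
          gcongr
          nlinarith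
      _ = _ := by ring
  have hen := sqrt_energy_le hab hA.continuousOn hZ hAmin hZ0 hZ1 hDe.le (by positivity)
    (by positivity) hid hdπ hε (Hpoinc M e)
  filter_upwards [M.ae_exists_mem_Ioo] with x hx
  obtain ⟨i, hxi⟩ := hx
  have hxi' := Ioo_subset_Icc_self hxi
  have hS0 := e.energy_nonneg (k + 1)
  set S := e.energy (k + 1) with hS
  have h1 : |(e.interior i).eval x| ≤ √De * √S := by
    refine abs_le_of_sq_le_sq ?_ (by positivity)
    rw [mul_pow, Real.sq_sqrt hDe.le, Real.sq_sqrt hS0]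
    exact Hpoinc M e i x hxi'
  have h2 : √S ≤ (2 * KA * (1 + Cm) + KZ * (Dp * Da) * √De * (b - a)) / amin * (K * η) := by
    rw [div_mul_eq_mul_div, le_div_iff₀ hamin]
    linarith
  rw [uh.fn_eq hxi]
  calc |U x - (uh.interior i).eval x|
      = |(U x - (p i).eval x) + (e.interior i).eval x| := by
        rw [heI, eval_sub]; congr 1; ring
    _ ≤ |U x - (p i).eval x| + |(e.interior i).eval x| := abs_add_le _ _
    _ ≤ Dp * Da * K * η + √De *
        ((2 * KA * (1 + Cm) + KZ * (Dp * Da) * √De * (b - a)) / amin * (K * η)) :=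
        add_le_add (hε i x hxi') (h1.trans (by gcongr))
    _ = _ := by ring

theorem hasTrace_unique {a b x c : ℝ} (hab : a < b) (hx : x ∈ Icc a b) {u w : ℝ → ℝ}
    (h : HasTrace a b u x c) (hw : ContinuousOn w (Icc a b))
    (hwu : w =ᵐ[volume.restrict (Ioo a b)] u) : w x = c := by
  obtain ⟨v, hv, hvu, hvc⟩ := h
  rw [← hvc]
  exact ae_eq_on_continuousOn hab hw hv (hwu.trans hvu.symm) hx

theorem le_of_ae_le {a b c : ℝ} (hab : a < b) {w : ℝ → ℝ} (hw : ContinuousOn w (Icc a b))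
    (h : ∀ᵐ x ∂volume.restrict (Ioo a b), c ≤ w x) : ∀ x ∈ Icc a b, c ≤ w x := by
  intro x hx
  have h1 : EqOn w (fun x => max (w x) c) (Icc a b) := by
    refine ae_eq_on_continuousOn hab hw (hw.sup continuousOn_const) ?_
    filter_upwards [h] with y hy
    exact (max_eq_left hy).symm
  rw [h1 hx]
  exact le_max_right _ _

theorem IsWeakFESolution.congr {a b : ℝ} (hab : a ≤ b) {M : Mesh a b} {k r : ℕ}
    {a₂ a₀ A Z f : ℝ → ℝ} {uh : FESpace M k} (h : IsWeakFESolution r a₂ a₀ f uh)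
    (hA : A =ᵐ[volume.restrict (Ioo a b)] a₂) (hZ : Z =ᵐ[volume.restrict (Ioo a b)] a₀) :
    IsWeakFESolution r A Z f uh := by
  intro v
  rw [← h v]
  congr 1
  · refine Finset.sum_congr rfl fun i _ => ?_
    refine intervalIntegral_congr_ae_Ioo (M.left_mem i).1 (M.left_lt_right i).le
      (M.right_mem i).2 ?_
    filter_upwards [hA] with x hx
    rw [hx]
  · refine intervalIntegral_congr_ae_Ioo le_rfl hab le_rfl ?_
    filter_upwards [hZ] with x hx
    rw [hx]

end WeakFE

end

theorem theorem4p6 (a b : ℝ) (hab : a < b) (k : ℕ) (s : ℝ) (hs0 : 0 ≤ s) (hsk : s ≤ k)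
    (a₂ a₀ : ℝ → ℝ) (amin : ℝ) (hamin : 0 < amin)
    (ha₂ : WeakFE.MemSobolev a b (s + 1) a₂)
    (ha₂_ge : ∀ᵐ x ∂(volume.restrict (Ioo a b)), amin ≤ a₂ x)
    (ha₀ : WeakFE.MemSobolev a b 1 a₀)
    (ha₀_nonneg : ∀ᵐ x ∂(volume.restrict (Ioo a b)), 0 ≤ a₀ x)
    (σ : ℝ) :
    ∃ C : ℝ, 0 < C ∧
      ∀ (M : WeakFE.Mesh a b), M.QuasiUniform σ →
      ∀ (f u : ℝ → ℝ) (uh : WeakFE.FESpace M k),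
        MemLp f 2 (volume.restrict (Ioo a b)) →
        WeakFE.IsSolution a b a₂ a₀ f u →
        WeakFE.MemSobolev a b (s + 2) u →
        WeakFE.IsWeakFESolution (k + 1) a₂ a₀ f uh →
        eLpNorm (fun x => u x - uh.fn x) ∞ (volume.restrict (Ioo a b))
          ≤ ENNReal.ofReal (C * M.size ^ (s + 1)) * WeakFE.sobolevNorm a b (s + 2) u := by
  have hm1 : ⌊s + 1⌋₊ = ⌊s⌋₊ + 1 := Nat.floor_add_one hs0
  have hm2 : ⌊s + 2⌋₊ = ⌊s⌋₊ + 2 := by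
    rw [show s + 2 = s + 1 + 1 by ring, Nat.floor_add_one (by linarith), hm1]
  have hθ1 : Int.fract (s + 1) = Int.fract s := Int.fract_add_one s
  have hθ2 : Int.fract (s + 2) = Int.fract s := by
    rw [show s + 2 = s + 1 + 1 by ring, Int.fract_add_one, hθ1]
  have hs : (⌊s⌋₊ : ℝ) + Int.fract s = s := by
    rw [natCast_floor_eq_intCast_floor hs0]
    exact Int.floor_add_fract s
  obtain ⟨CA, hCA, HA⟩ := WeakFE.MemSobolev.exists_sobBound hab (s + 1)
  obtain ⟨A, hA, hAb⟩ := HA a₂ ha₂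
  rw [hm1, hθ1] at hAb
  obtain ⟨CZ, hCZ, HZ⟩ := WeakFE.MemSobolev.exists_sobBound hab 1
  obtain ⟨Z, hZ, hZb⟩ := HZ a₀ ha₀
  rw [show ⌊(1 : ℝ)⌋₊ = 0 + 1 by simp] at hZb
  obtain ⟨CU, hCU, HU⟩ := WeakFE.MemSobolev.exists_sobBound hab (s + 2)
  have hAmin : ∀ x ∈ Icc a b, amin ≤ A x := WeakFE.le_of_ae_le hab hAb.continuousOn (by
    filter_upwards [hA, ha₂_ge] with x h1 h2
    rwa [h1])
  have hZ0 : ∀ x ∈ Icc a b, 0 ≤ Z x := WeakFE.le_of_ae_le hab hZb.continuousOn (by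
    filter_upwards [hZ, ha₀_nonneg] with x h1 h2
    rwa [h1])
  obtain ⟨C, hC, H⟩ := WeakFE.exists_sup_error_le hab k ⌊s⌋₊ (Int.fract_nonneg s)
    (Int.fract_lt_one s) (by rw [hs]; exact hsk) hamin
    (mul_nonneg hCA.le ENNReal.toReal_nonneg) hAb hAmin hZb.continuousOn hZ0 hZb.1
  refine ⟨C * CU, by positivity, fun M _ f u uh _ hsol hu huh => ?_⟩
  obtain ⟨U, hUu, hUb⟩ := HU u hu
  rw [hm2, hθ2] at hUb
  set N := (WeakFE.sobolevNorm a b (s + 2) u).toReal with hN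
  have hN0 : 0 ≤ N := ENNReal.toReal_nonneg
  obtain ⟨-, G, hGb, hUG⟩ := id hUb
  have hGu : G =ᵐ[volume.restrict (Ioo a b)] WeakFE.weakDeriv a b 1 u :=
    ((hUG.isWeakDeriv hab).congr_left hUu).unique
      (hu.weakDeriv_spec (by rw [hm2]; omega)).1
  have hmain := H M f U G (CU * N) uh (by positivity) hUb hGb hUG
    (WeakFE.hasTrace_unique hab (left_mem_Icc.2 hab.le) hsol.left_bc hUG.continuousOn hUu)
    (WeakFE.hasTrace_unique hab (right_mem_Icc.2 hab.le) hsol.right_bc hGb.continuousOn hGu)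
    (fun R hR => by
      have h1 := hsol.eqn.congr_left (v := fun x => A x * G x) (by
        filter_upwards [hA, hGu] with x h1 h2
        rw [h1, h2])
      filter_upwards [(hR.isWeakDeriv hab).unique h1, hZ, hUu] with x h2 h3 h4
      rw [h2, h3, h4]
      ring)
    (huh.congr hab.le hA hZ)
  have hpow : M.size ^ (s + 1) = M.size * (M.size ^ ⌊s⌋₊ * M.size ^ Int.fract s) := by
    rw [Real.rpow_add_of_nonneg M.size_nonneg hs0 zero_le_one, Real.rpow_one]
    conv_lhs => rw [← hs]
    rw [Real.rpow_add_of_nonneg M.size_nonneg (by positivity) (Int.fract_nonneg s),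
      Real.rpow_natCast]
    ring
  have hsize := M.size_nonneg
  rw [← ENNReal.ofReal_toReal (hu.sobolevNorm_spec hab.le).1,
    ← ENNReal.ofReal_mul (by positivity), eLpNorm_exponent_top]
  refine eLpNormEssSup_le_of_ae_bound ?_
  filter_upwards [hmain, hUu] with x h1 h2
  rw [Real.norm_eq_abs, ← h2]
  refine h1.trans_eq ?_
  rw [hpow]
  ring
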